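/- Let $\nu>0$, let $\alpha:\{1,2,\dots\}\to[0,\infty)$ be not identically zero with $\|\alpha\|_1:=\sum_{t\ge1}\alpha(t)<\infty$, and let $(\ell_{t,j})_{t,j\ge1}$ be i.i.d. positive integrable random variables; write $\ell=\ell_{1,1}$. Let $Z_1,Z_2,\dots$ be $\mathbb{N}$-valued random variables and put $X_t=\sum_{j=1}^{Z_t}\ell_{t,j}$, $\lambda_t=\nu+\sum_{s=1}^{t-1}\alpha(s)X_{t-s}$ and $N_t=\sum_{s=1}^tZ_s$. Assume that for every $t\ge1$, conditionally on $(Z_s,X_s)_{1\le s<t}$, $Z_t$ is Poisson with mean $\lambda_t$, and that $(\ell_{t,j})_{j\ge1}$ is independent of $(Z_s,X_s)_{1\le s<t}$ and $Z_t$ jointly. Assume $\|\alpha\|_1\mathbb{E}[\ell]<1$. Call $x_c>1$ a critical point if $x_c\,\mathbb{E}[\|\alpha\|_1\ell e^{\|\alpha\|_1\ell(x_c-1)}]=\mathbb{E}[e^{\|\alpha\|_1\ell(x_c-1)}]$ with both expectations finite. There is at most one critical point, and there is one whenever the set $\{u\in\mathbb{R}:\mathbb{E}[e^{u\ell}]<\infty\}$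 is open (for instance, when $\ell$ has all exponential moments). Suppose a critical point $x_c$ exists and put $\theta_c:=-\log\mathbb{E}[\|\alpha\|_1\ell e^{\|\alpha\|_1\ell(x_c-1)}]$. Then: (a) $\theta_c>0$, and at $\theta=\theta_c$ the point $x_c$ is a double root of the equation $$x=\mathbb{E}\big[e^{\theta+\|\alpha\|_1\ell(x-1)}\big],\qquad(\ast)$$ that is, $x_c$ solves $(\ast)$ and $\mathbb{E}[\|\alpha\|_1\ell e^{\theta_c+\|\alpha\|_1\ell(x_c-1)}]=1$; (b) for every $\theta\le\theta_c$ equation $(\ast)$ has a minimal real solution $g(\theta)$, and for $\theta>\theta_c$ it has no real solution (the expectation being required to be finite); (c) with $\Gamma(\theta):=\nu(g(\theta)-1)$, the laws $\mathbb{P}(N_t/t\in\cdot)$ satisfy the large deviation principle on $\mathbb{R}$ as $t\to\infty$ with speed $t$ and rate function $I(x)=\sup_{\theta\le\theta_c}\{\theta x-\Gamma(\theta)\}$: $I:\mathbb{R}\to[0,\infty]$ is lower semicontinuous, and for every Borel set $A$, with interior $A^\circ$ and closure $\overline A$, $$-\inf_{x\in A^\circ}I(x)\le\liminf_{t\to\infty}\frac1t\log\mathbb{P}(N_t/t\in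 A)\le\limsup_{t\to\infty}\frac1t\log\mathbb{P}(N_t/t\in A)\le-\inf_{x\in\overline A}I(x).$$ -/

import Mathlib

open MeasureTheory ProbabilityTheory Filter Topology

noncomputable section

namespace HawkesLDP

/-- `μ` satisfies the large deviation principle with speed `a` and rate function
`I : X → [0, ∞]`; logarithms of probabilities are extended-real, with `log 0 = -∞`. -/
structure LargeDeviationPrinciple {X : Type*} [TopologicalSpace X] [MeasurableSpace X]
    (μ : ℕ → Measure X) (a : ℕ → ℝ) (I : X → EReal) : Prop where
  lowerSemicontinuous : LowerSemicontinuous I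
  nonneg : ∀ x, 0 ≤ I x
  speed_mono : Monotone a
  speed_tendsto : Tendsto a atTop atTop
  lower_bound : ∀ A : Set X, MeasurableSet A →
    -(⨅ x ∈ interior A, I x) ≤
      liminf (fun n => (((a n)⁻¹ : ℝ) : EReal) * ENNReal.log (μ n A)) atTop
  upper_bound : ∀ A : Set X, MeasurableSet A →
    limsup (fun n => (((a n)⁻¹ : ℝ) : EReal) * ENNReal.log (μ n A)) atTop ≤
      -(⨅ x ∈ closure A, I x)

section Model

variable {Ω : Type*}

/-- `‖α‖₁ = ∑_{t ≥ 1} α(t)` for a nonnegative `α`; the value `α 0` is never used. -/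
def l1Norm (α : ℕ → ℝ) : ℝ := ∑' t : ℕ, α (t + 1)

/-- `X_t = ∑_{j=1}^{Z_t} ℓ_{t,j}`. -/
def compoundMark (ℓ : ℕ → ℕ → Ω → ℝ) (Z : ℕ → Ω → ℕ) (t : ℕ) (ω : Ω) : ℝ :=
  ∑ j ∈ Finset.Icc 1 (Z t ω), ℓ t j ω

/-- `λ_t = ν + ∑_{s=1}^{t-1} α(s) X_{t-s}`. -/
def intensity (ν : ℝ) (α : ℕ → ℝ) (ℓ : ℕ → ℕ → Ω → ℝ) (Z : ℕ → Ω → ℕ) (t : ℕ) (ω : Ω) : ℝ :=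
  ν + ∑ s ∈ Finset.Ico 1 t, α s * compoundMark ℓ Z (t - s) ω

/-- `N_t = ∑_{s=1}^{t} Z_s`. -/
def count (Z : ℕ → Ω → ℕ) (t : ℕ) (ω : Ω) : ℕ := ∑ s ∈ Finset.Icc 1 t, Z s ω

/-- The history before time `t`: the σ-algebra generated by `Z_s, X_s`, `1 ≤ s < t`. -/
def history (ℓ : ℕ → ℕ → Ω → ℝ) (Z : ℕ → Ω → ℕ) (t : ℕ) : MeasurableSpace Ω :=
  ⨆ s ∈ Set.Ico 1 t,
    (MeasurableSpace.comap (Z s) inferInstance ⊔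
      MeasurableSpace.comap (compoundMark ℓ Z s) inferInstance)

/-- `(Z_t)_{t ≥ 1}` are the counts of a discrete-time marked Hawkes process with base rate `ν`,
exciting function `α` and marks `(ℓ_{t,j})_{t,j ≥ 1}`. -/
structure IsMarkedHawkes [MeasurableSpace Ω] (P : Measure Ω) (ν : ℝ) (α : ℕ → ℝ)
    (ℓ : ℕ → ℕ → Ω → ℝ) (Z : ℕ → Ω → ℕ) : Prop where
  measurable_mark : ∀ t j, 1 ≤ t → 1 ≤ j → Measurable (ℓ t j)
  measurable_count : ∀ t, 1 ≤ t → Measurable (Z t)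
  /-- the marks are positive … -/
  mark_pos : ∀ t j, 1 ≤ t → 1 ≤ j → ∀ᵐ ω ∂P, 0 < ℓ t j ω
  /-- … and i.i.d. in both indices -/
  mark_iIndep : iIndepFun (fun p : ℕ × ℕ => ℓ (p.1 + 1) (p.2 + 1)) P
  mark_identDistrib : ∀ t j, 1 ≤ t → 1 ≤ j → IdentDistrib (ℓ t j) (ℓ 1 1) P P
  /-- given the history before `t`, the count `Z_t` is Poisson with mean `λ_t` … -/
  cond_poisson : ∀ t, 1 ≤ t → ∀ k : ℕ,
    P[(Z t ⁻¹' {k}).indicator (fun _ => (1 : ℝ)) | history ℓ Z t] =ᵐ[P]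
      fun ω => Real.exp (-intensity ν α ℓ Z t ω) * intensity ν α ℓ Z t ω ^ k / (k.factorial : ℝ)
  /-- … and the marks at time `t` are independent of the history before `t` and of `Z_t` -/
  mark_indep : ∀ t, 1 ≤ t →
    Indep (⨆ j ∈ Set.Ici 1, MeasurableSpace.comap (ℓ t j) inferInstance)
      (history ℓ Z t ⊔ MeasurableSpace.comap (Z t) inferInstance) P

end Model

section Rate

variable {Ω : Type*} [MeasurableSpace Ω]

/-- The real solutions `x` of `x = E[exp(θ + a Y (x - 1))]` (with finite expectation). -/
def fixedPoints (P : Measure Ω) (a : ℝ) (Y : Ω → ℝ) (θ : ℝ) : Set ℝ :=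
  {x | Integrable (fun ω => Real.exp (θ + a * Y ω * (x - 1))) P ∧
    x = ∫ ω, Real.exp (θ + a * Y ω * (x - 1)) ∂P}

/-- The minimal solution `g(θ)`; meaningful when the set of solutions has a least element. -/
def minFixedPoint (P : Measure Ω) (a : ℝ) (Y : Ω → ℝ) (θ : ℝ) : ℝ :=
  sInf (fixedPoints P a Y θ)

/-- `x > 1` satisfies `x E[a Y exp(a Y (x - 1))] = E[exp(a Y (x - 1))]`, both finite. -/
def IsCriticalPoint (P : Measure Ω) (a : ℝ) (Y : Ω → ℝ) (x : ℝ) : Prop :=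
  1 < x ∧
  Integrable (fun ω => Real.exp (a * Y ω * (x - 1))) P ∧
  Integrable (fun ω => a * Y ω * Real.exp (a * Y ω * (x - 1))) P ∧
  x * ∫ ω, a * Y ω * Real.exp (a * Y ω * (x - 1)) ∂P = ∫ ω, Real.exp (a * Y ω * (x - 1)) ∂P

/-- `θ_c = -log E[a Y exp(a Y (x_c - 1))]`. -/
def criticalTheta (P : Measure Ω) (a : ℝ) (Y : Ω → ℝ) (xc : ℝ) : ℝ :=
  -Real.log (∫ ω, a * Y ω * Real.exp (a * Y ω * (xc - 1)) ∂P)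

/-- `Γ(θ) = ν (g(θ) - 1)`. -/
def limitLogMGF (P : Measure Ω) (ν a : ℝ) (Y : Ω → ℝ) (θ : ℝ) : ℝ :=
  ν * (minFixedPoint P a Y θ - 1)

/-- `I(x) = sup_{θ ≤ θ_c} (θ x - Γ(θ))`, an extended real number. -/
def rateFunction (P : Measure Ω) (ν a : ℝ) (Y : Ω → ℝ) (θc : ℝ) (x : ℝ) : EReal :=
  ⨆ θ ∈ Set.Iic θc, ((θ * x - limitLogMGF P ν a Y θ : ℝ) : EReal)

end Rate

end HawkesLDP

end

/-!
Write `V = ‖α‖₁ ℓ` for the mean offspring of a point and `f(x) = E[exp(V (x - 1))]` for the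
offspring generating function, so that the fixed-point equation reads `x = e^θ f(x)`.

*The fixed-point equation.* A positive `x` in the domain of `f` solves it exactly for
`θ = T(x) := log x - log f(x)`. At a critical point `x_c` the tangent to the strictly convex `f`
passes through the origin, so `x_c` is the strict global minimizer of `f(x) / x`, that is, the
strict maximizer of `T`, and `T` is strictly increasing from `(0, x_c]` onto `(-∞, θ_c]`. Hence `g` is
the inverse of `T` on `(0, x_c]`, and all later arguments are parametrized by `x = g(θ)`, for which
`Γ(θ) = ν (x - 1)`. If the domain of `f` is open, `f(x) / x` has an interior minimum on `x > 1`
(`exists_isCritical`).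

*Exponential moments.* Integrating out the counts and marks backwards in time, one step at a time,
gives `log E[e^{θ N_t}] = ν ∑_{k ≤ t} (u_k - 1)` (`IsMarkedHawkes.lintegral_exp_count`), where `u_k`
is the generating function of the part of a cluster born within `k` time units. The sequence `u_k`
is monotone in `k` and stays in the domain of `f` for `θ ≤ θ_c`; its limit is a fixed point in
`(0, x_c]`, hence equal to `g(θ)` (`tendsto_clusterGF`). A Cesàro mean then gives
`t⁻¹ log E[e^{θ N_t}] → Γ(θ)` for every `θ ≤ θ_c`.

*Large deviations.* The upper bound only needs these limits at parameters of both signs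
(`limsup_le_neg_iInf_closure`). For the lower bound, `T` tends to `-∞` at `0`, and its left slope
vanishes at the double root `x_c`, which is the steepness of `Γ` at `θ_c`. So `T'` takes every value
`ν / y` with `y > 0`, every such `y` is an exposed point, and tilting applies
(`neg_le_liminf_of_exposed`). On `(-∞, 0)` the rate is infinite, and `0` is reached as a limit of
positive points because `I(0) = ν`.
-/

noncomputable section

namespace HawkesLDP

/-! ### The offspring generating function and its critical point -/

section Offspring

variable {Ω : Type*} [MeasurableSpace Ω]

/-- `f(x) = E[exp(V (x - 1))]`, the generating function of a Poisson number of offspring with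
random mean `V`. The integral has the junk value `0` outside the domain of finiteness, so
integrability is carried separately. -/
def offspringGF (P : Measure Ω) (V : Ω → ℝ) (x : ℝ) : ℝ := ∫ ω, Real.exp (V ω * (x - 1)) ∂P

/-- `f'(x) = E[V exp(V (x - 1))]`. -/
def offspringGFDeriv (P : Measure Ω) (V : Ω → ℝ) (x : ℝ) : ℝ :=
  ∫ ω, V ω * Real.exp (V ω * (x - 1)) ∂P

/-- The parameter `T(x) = log x - log f(x)` at which `x` solves `x = e^θ f(x)`. -/
def rootParam (P : Measure Ω) (V : Ω → ℝ) (x : ℝ) : ℝ := Real.log x - Real.log (offspringGF P V x)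

/-- `x > 1` is a critical point for `V`: `x f'(x) = f(x)`, both expectations finite. This is
`IsCriticalPoint` in terms of the product `V = a Y`. -/
structure IsCritical (P : Measure Ω) (V : Ω → ℝ) (x : ℝ) : Prop where
  one_lt : 1 < x
  integrable_exp : Integrable (fun ω => Real.exp (V ω * (x - 1))) P
  integrable_mul_exp : Integrable (fun ω => V ω * Real.exp (V ω * (x - 1))) P
  eq : x * offspringGFDeriv P V x = offspringGF P V x

variable {P : Measure Ω} {V : Ω → ℝ}

lemma integrable_exp_of_le (hm : AEMeasurable V P) (hV : ∀ᵐ ω ∂P, 0 < V ω) {x y : ℝ} (hxy : x ≤ y)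
    (h : Integrable (fun ω => Real.exp (V ω * (y - 1))) P) :
    Integrable (fun ω => Real.exp (V ω * (x - 1))) P := by
  refine h.mono' (by fun_prop) ?_
  filter_upwards [hV] with ω hω
  rw [Real.norm_eq_abs, Real.abs_exp]
  gcongr

lemma integrable_mul_exp_of_le (hm : AEMeasurable V P) (hV : ∀ᵐ ω ∂P, 0 < V ω) {x y : ℝ}
    (hxy : x ≤ y) (h : Integrable (fun ω => V ω * Real.exp (V ω * (y - 1))) P) :
    Integrable (fun ω => V ω * Real.exp (V ω * (x - 1))) P := by
  refine h.mono' (by fun_prop) ?_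
  filter_upwards [hV] with ω hω
  rw [norm_mul, Real.norm_eq_abs, Real.norm_eq_abs, Real.abs_exp, abs_of_pos hω]
  gcongr

lemma continuousOn_offspringGF (hm : AEMeasurable V P) (hV : ∀ᵐ ω ∂P, 0 < V ω) {y : ℝ}
    (h : Integrable (fun ω => Real.exp (V ω * (y - 1))) P) :
    ContinuousOn (offspringGF P V) (Set.Iic y) := by
  refine continuousOn_of_dominated (bound := fun ω => Real.exp (V ω * (y - 1)))
    (fun x _ => by fun_prop) (fun x hx => ?_) h (ae_of_all _ fun ω => by fun_prop)
  filter_upwards [hV] with ω hω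
  rw [Real.norm_eq_abs, Real.abs_exp]
  have : x ≤ y := hx
  gcongr

lemma continuousOn_offspringGFDeriv (hm : AEMeasurable V P) (hV : ∀ᵐ ω ∂P, 0 < V ω) {y : ℝ}
    (h : Integrable (fun ω => V ω * Real.exp (V ω * (y - 1))) P) :
    ContinuousOn (offspringGFDeriv P V) (Set.Iic y) := by
  refine continuousOn_of_dominated (bound := fun ω => V ω * Real.exp (V ω * (y - 1)))
    (fun x _ => by fun_prop) (fun x hx => ?_) h (ae_of_all _ fun ω => by fun_prop)
  filter_upwards [hV] with ω hω
  rw [norm_mul, Real.norm_eq_abs, Real.norm_eq_abs, Real.abs_exp, abs_of_pos hω]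
  have : x ≤ y := hx
  gcongr

lemma rootParam_lt_iff {x y : ℝ} (hx : 0 < x) (hy : 0 < y) (hfx : 0 < offspringGF P V x)
    (hfy : 0 < offspringGF P V y) :
    rootParam P V x < rootParam P V y ↔ offspringGF P V y * x < offspringGF P V x * y := by
  unfold rootParam
  rw [← Real.log_div hx.ne' hfx.ne', ← Real.log_div hy.ne' hfy.ne',
    Real.log_lt_log_iff (by positivity) (by positivity), div_lt_div_iff₀ hfx hfy,
    mul_comm x, mul_comm y]

lemma eq_exp_mul_offspringGF_iff {x θ : ℝ} (hx : 0 < x) (hfx : 0 < offspringGF P V x) :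
    x = Real.exp θ * offspringGF P V x ↔ rootParam P V x = θ := by
  unfold rootParam
  constructor
  · intro h
    have := congrArg Real.log h
    rw [Real.log_mul (Real.exp_pos _).ne' hfx.ne', Real.log_exp] at this
    linarith
  · intro h
    have h' : Real.log x = θ + Real.log (offspringGF P V x) := by linarith
    rw [← Real.exp_log hfx, ← Real.exp_add, ← h', Real.exp_log hx]

lemma offspringGF_mono (hm : AEMeasurable V P) (hV : ∀ᵐ ω ∂P, 0 < V ω) {x y : ℝ} (hxy : x ≤ y)
    (h : Integrable (fun ω => Real.exp (V ω * (y - 1))) P) :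
    offspringGF P V x ≤ offspringGF P V y := by
  refine integral_mono_ae (integrable_exp_of_le hm hV hxy h) h ?_
  filter_upwards [hV] with ω hω
  gcongr

lemma mem_interior_integrableExpSet (hm : AEMeasurable V P) (hV : ∀ᵐ ω ∂P, 0 < V ω) {x y : ℝ}
    (hxy : x < y) (h : Integrable (fun ω => Real.exp (V ω * (y - 1))) P) :
    x - 1 ∈ interior (integrableExpSet V P) := by
  refine mem_interior.2 ⟨Set.Iio (y - 1), fun t ht => ?_, isOpen_Iio, by simpa using hxy⟩
  have ht' : t + 1 ≤ y := by have : t < y - 1 := ht; linarith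
  have := integrable_exp_of_le hm hV ht' h
  simpa [integrableExpSet, mul_comm] using this

lemma hasDerivAt_offspringGF (hm : AEMeasurable V P) (hV : ∀ᵐ ω ∂P, 0 < V ω) {x y : ℝ}
    (hxy : x < y) (h : Integrable (fun ω => Real.exp (V ω * (y - 1))) P) :
    HasDerivAt (offspringGF P V) (offspringGFDeriv P V x) x := by
  have h1 := hasDerivAt_mgf (mem_interior_integrableExpSet hm hV hxy h)
  have h2 := h1.comp_sub_const x 1
  have e1 : offspringGF P V = fun x => mgf V P (x - 1) := by
    funext z; simp [offspringGF, mgf, mul_comm]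
  have e2 : offspringGFDeriv P V x = ∫ ω, V ω * Real.exp ((x - 1) * V ω) ∂P := by
    simp [offspringGFDeriv, mul_comm]
  rw [e1, e2]
  exact h2

lemma integrable_mul_exp_of_lt (hm : AEMeasurable V P) (hV : ∀ᵐ ω ∂P, 0 < V ω) {x y : ℝ}
    (hxy : x < y) (h : Integrable (fun ω => Real.exp (V ω * (y - 1))) P) :
    Integrable (fun ω => V ω * Real.exp (V ω * (x - 1))) P := by
  have := integrable_pow_mul_exp_of_mem_interior_integrableExpSet
    (mem_interior_integrableExpSet hm hV hxy h) 1
  simpa [mul_comm] using this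

/-- Convexity of `f` on its domain. -/
lemma offspringGF_convex {x y s t : ℝ} (hx : Integrable (fun ω => Real.exp (V ω * (x - 1))) P)
    (hy : Integrable (fun ω => Real.exp (V ω * (y - 1))) P)
    (hs : 0 ≤ s) (ht : 0 ≤ t) (hst : s + t = 1) :
    offspringGF P V (s * x + t * y) ≤ s * offspringGF P V x + t * offspringGF P V y := by
  unfold offspringGF
  rw [← integral_const_mul, ← integral_const_mul,
    ← integral_add (hx.const_mul s) (hy.const_mul t)]
  refine integral_mono_of_nonneg (ae_of_all _ fun _ => (Real.exp_pos _).le)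
    ((hx.const_mul s).add (hy.const_mul t)) (ae_of_all _ fun ω => ?_)
  have := convexOn_exp.2 (Set.mem_univ (V ω * (x - 1))) (Set.mem_univ (V ω * (y - 1))) hs ht hst
  simp only [smul_eq_mul] at this
  refine le_trans (Real.exp_le_exp.2 (le_of_eq ?_)) this
  linear_combination (V ω) * hst

variable [IsProbabilityMeasure P]

lemma integral_pos_of_ae_pos {f : Ω → ℝ} (hf : Integrable f P) (hpos : ∀ᵐ ω ∂P, 0 < f ω) :
    0 < ∫ ω, f ω ∂P := by
  rw [integral_pos_iff_support_of_nonneg_ae (hpos.mono fun _ h => h.le) hf]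
  have : Function.support f =ᵐ[P] Set.univ := by
    filter_upwards [hpos] with ω h
    have : ω ∈ Function.support f := h.ne'
    exact propext ⟨fun _ => trivial, fun _ => this⟩
  rw [measure_congr this]
  simp

lemma offspringGF_pos {x : ℝ} (h : Integrable (fun ω => Real.exp (V ω * (x - 1))) P) :
    0 < offspringGF P V x :=
  integral_pos_of_ae_pos h (ae_of_all _ fun _ => Real.exp_pos _)

lemma offspringGF_one : offspringGF P V 1 = 1 := by simp [offspringGF]

/-- Strict convexity of `f`: the graph lies strictly above its tangents. -/
lemma tangent_lt_offspringGF (hV : ∀ᵐ ω ∂P, 0 < V ω) {x y : ℝ} (hxy : x ≠ y)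
    (hx : Integrable (fun ω => Real.exp (V ω * (x - 1))) P)
    (hy : Integrable (fun ω => Real.exp (V ω * (y - 1))) P)
    (hy' : Integrable (fun ω => V ω * Real.exp (V ω * (y - 1))) P) :
    offspringGF P V y + offspringGFDeriv P V y * (x - y) < offspringGF P V x := by
  have hpos := integral_pos_of_ae_pos (P := P)
    (f := fun ω => Real.exp (V ω * (x - 1)) -
      (Real.exp (V ω * (y - 1)) + V ω * Real.exp (V ω * (y - 1)) * (x - y)))
    (hx.sub (hy.add (hy'.mul_const _))) (by
      filter_upwards [hV] with ω hω
      have h1 : V ω * (x - y) ≠ 0 := mul_ne_zero hω.ne' (sub_ne_zero.2 hxy)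
      have h2 := Real.add_one_lt_exp h1
      have h3 : Real.exp (V ω * (x - 1)) = Real.exp (V ω * (y - 1)) * Real.exp (V ω * (x - y)) := by
        rw [← Real.exp_add]; ring_nf
      have h4 := Real.exp_pos (V ω * (y - 1))
      rw [h3]
      nlinarith)
  have hsum : Integrable (fun ω => Real.exp (V ω * (y - 1)) +
      V ω * Real.exp (V ω * (y - 1)) * (x - y)) P := hy.add (hy'.mul_const _)
  rw [integral_sub hx hsum, integral_add hy (hy'.mul_const _), integral_mul_const] at hpos
  unfold offspringGF offspringGFDeriv
  linarith

/-- A critical point is the strict global minimizer of `f(x) / x`: the tangent to `f` at `x_c`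
passes through the origin. -/
lemma IsCritical.offspringGF_mul_lt {xc : ℝ} (hc : IsCritical P V xc) (hV : ∀ᵐ ω ∂P, 0 < V ω)
    {x : ℝ} (hx : Integrable (fun ω => Real.exp (V ω * (x - 1))) P) (hne : x ≠ xc) :
    offspringGF P V xc * x < offspringGF P V x * xc := by
  have h := tangent_lt_offspringGF hV hne hx hc.integrable_exp hc.integrable_mul_exp
  have h0 := hc.one_lt
  have := mul_lt_mul_of_pos_right h (by linarith : 0 < xc)
  refine lt_of_eq_of_lt ?_ this
  linear_combination (xc - x) * hc.eq

lemma IsCritical.unique {x y : ℝ} (hx : IsCritical P V x) (hy : IsCritical P V y)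
    (hV : ∀ᵐ ω ∂P, 0 < V ω) : x = y := by
  by_contra h
  have h1 := hy.offspringGF_mul_lt hV hx.integrable_exp h
  have h2 := hx.offspringGF_mul_lt hV hy.integrable_exp (Ne.symm h)
  exact lt_asymm h1 h2

/-- `f(x) / x` is strictly decreasing on `(0, x_c]`. -/
lemma IsCritical.offspringGF_mul_lt_of_lt {xc : ℝ} (hc : IsCritical P V xc)
    (hm : AEMeasurable V P) (hV : ∀ᵐ ω ∂P, 0 < V ω) {x y : ℝ} (hx : 0 < x) (hxy : x < y)
    (hy : y ≤ xc) : offspringGF P V y * x < offspringGF P V x * y := by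
  have hd : 0 < xc - x := by linarith
  have hix := integrable_exp_of_le hm hV (hxy.le.trans hy) hc.integrable_exp
  have hcv := offspringGF_convex (s := (xc - y) / (xc - x)) (t := (y - x) / (xc - x)) hix
    hc.integrable_exp (div_nonneg (by linarith) hd.le) (div_nonneg (by linarith) hd.le)
    (by field_simp; ring)
  have e : (xc - y) / (xc - x) * x + (y - x) / (xc - x) * xc = y := by field_simp; ring
  rw [e] at hcv
  have hlt := hc.offspringGF_mul_lt hV hix (by linarith)
  have hcv' : offspringGF P V y * (xc - x) ≤
      (xc - y) * offspringGF P V x + (y - x) * offspringGF P V xc := by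
    have := mul_le_mul_of_nonneg_right hcv hd.le
    refine this.trans (le_of_eq ?_)
    field_simp
  have h1 := mul_le_mul_of_nonneg_right hcv' hx.le
  have h2 : offspringGF P V y * x * (xc - x) < offspringGF P V x * y * (xc - x) := by
    nlinarith [mul_lt_mul_of_pos_left hlt (by linarith : 0 < y - x)]
  exact lt_of_mul_lt_mul_right h2 hd.le

lemma IsCritical.strictMonoOn_rootParam {xc : ℝ} (hc : IsCritical P V xc)
    (hm : AEMeasurable V P) (hV : ∀ᵐ ω ∂P, 0 < V ω) :
    StrictMonoOn (rootParam P V) (Set.Ioc 0 xc) := by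
  intro x hx y hy hxy
  rw [rootParam_lt_iff hx.1 hy.1
    (offspringGF_pos (integrable_exp_of_le hm hV hx.2 hc.integrable_exp))
    (offspringGF_pos (integrable_exp_of_le hm hV hy.2 hc.integrable_exp))]
  exact hc.offspringGF_mul_lt_of_lt hm hV hx.1 hxy hy.2

lemma IsCritical.rootParam_lt {xc : ℝ} (hc : IsCritical P V xc) (hV : ∀ᵐ ω ∂P, 0 < V ω) {x : ℝ}
    (hx0 : 0 < x) (hx : Integrable (fun ω => Real.exp (V ω * (x - 1))) P) (hne : x ≠ xc) :
    rootParam P V x < rootParam P V xc := by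
  rw [rootParam_lt_iff hx0 (by linarith [hc.one_lt]) (offspringGF_pos hx)
    (offspringGF_pos hc.integrable_exp)]
  exact hc.offspringGF_mul_lt hV hx hne

lemma rootParam_one : rootParam P V 1 = 0 := by simp [rootParam, offspringGF_one]

lemma IsCritical.rootParam_pos {xc : ℝ} (hc : IsCritical P V xc) (hV : ∀ᵐ ω ∂P, 0 < V ω) :
    0 < rootParam P V xc := by
  have := hc.rootParam_lt hV one_pos (by simp) hc.one_lt.ne
  rwa [rootParam_one] at this

lemma IsCritical.deriv_pos {xc : ℝ} (hc : IsCritical P V xc) : 0 < offspringGFDeriv P V xc := by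
  have h := hc.eq
  have h1 := offspringGF_pos hc.integrable_exp
  have h2 := hc.one_lt
  by_contra h3
  nlinarith

lemma IsCritical.rootParam_eq {xc : ℝ} (hc : IsCritical P V xc) :
    rootParam P V xc = -Real.log (offspringGFDeriv P V xc) := by
  unfold rootParam
  rw [← hc.eq, Real.log_mul (by linarith [hc.one_lt]) hc.deriv_pos.ne']
  ring

lemma IsCritical.continuousOn_rootParam {xc : ℝ} (hc : IsCritical P V xc)
    (hm : AEMeasurable V P) (hV : ∀ᵐ ω ∂P, 0 < V ω) :
    ContinuousOn (rootParam P V) (Set.Ioc 0 xc) := by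
  refine ContinuousOn.sub (Real.continuousOn_log.mono fun x hx => ?_)
    (ContinuousOn.log ((continuousOn_offspringGF hm hV hc.integrable_exp).mono fun x hx => hx.2)
      fun x hx => ?_)
  · exact hx.1.ne'
  · exact (offspringGF_pos (integrable_exp_of_le hm hV hx.2 hc.integrable_exp)).ne'

lemma IsCritical.rootParam_le_log_sub {xc : ℝ} (hc : IsCritical P V xc)
    (hm : AEMeasurable V P) (hV : ∀ᵐ ω ∂P, 0 < V ω) {x : ℝ} (hx : x ∈ Set.Ioc 0 xc) :
    rootParam P V x ≤ Real.log x - Real.log (offspringGF P V 0) := by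
  have h0 := integrable_exp_of_le hm hV (by linarith [hc.one_lt] : (0 : ℝ) ≤ xc) hc.integrable_exp
  unfold rootParam
  have := Real.log_le_log (offspringGF_pos h0) (offspringGF_mono hm hV hx.1.le
    (integrable_exp_of_le hm hV hx.2 hc.integrable_exp))
  linarith

/-- `T` maps `(0, x_c]` onto `(-∞, T(x_c)]`. -/
lemma IsCritical.exists_rootParam_eq {xc : ℝ} (hc : IsCritical P V xc)
    (hm : AEMeasurable V P) (hV : ∀ᵐ ω ∂P, 0 < V ω) {θ : ℝ} (hθ : θ ≤ rootParam P V xc) :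
    ∃ x ∈ Set.Ioc 0 xc, rootParam P V x = θ := by
  have hxc : 0 < xc := by linarith [hc.one_lt]
  set z := min xc (Real.exp (θ + Real.log (offspringGF P V 0))) with hz
  have hz0 : 0 < z := lt_min hxc (Real.exp_pos _)
  have hzc : z ≤ xc := min_le_left _ _
  have hzθ : rootParam P V z ≤ θ := by
    have h1 := hc.rootParam_le_log_sub hm hV ⟨hz0, hzc⟩
    have h2 : Real.log z ≤ θ + Real.log (offspringGF P V 0) := by
      rw [Real.log_le_iff_le_exp hz0]; exact min_le_right _ _
    linarith
  have hsub : Set.Icc z xc ⊆ Set.Ioc 0 xc := fun x hx => ⟨hz0.trans_le hx.1, hx.2⟩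
  obtain ⟨x, hx, hxe⟩ := intermediate_value_Icc hzc
    ((hc.continuousOn_rootParam hm hV).mono hsub) ⟨hzθ, hθ⟩
  exact ⟨x, hsub hx, hxe⟩

lemma IsCritical.hasDerivAt_rootParam {xc : ℝ} (hc : IsCritical P V xc)
    (hm : AEMeasurable V P) (hV : ∀ᵐ ω ∂P, 0 < V ω) {x : ℝ} (hx : x ∈ Set.Ioo 0 xc) :
    HasDerivAt (rootParam P V) (x⁻¹ - offspringGFDeriv P V x / offspringGF P V x) x := by
  have h0 := offspringGF_pos (integrable_exp_of_le hm hV hx.2.le hc.integrable_exp)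
  exact (Real.hasDerivAt_log hx.1.ne').sub
    ((hasDerivAt_offspringGF hm hV hx.2 hc.integrable_exp).log h0.ne')

/-- The left slope of `T` at the double root `x_c` is zero. -/
lemma IsCritical.exists_rootParam_sub_lt {xc : ℝ} (hc : IsCritical P V xc)
    (hm : AEMeasurable V P) (hV : ∀ᵐ ω ∂P, 0 < V ω) {ε : ℝ} (hε : 0 < ε) :
    ∃ x ∈ Set.Ioo 0 xc, rootParam P V xc - rootParam P V x < ε * (xc - x) := by
  have hxc : 0 < xc := by linarith [hc.one_lt]
  have hfc := offspringGF_pos hc.integrable_exp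
  have hcont : ContinuousWithinAt
      (fun x => x⁻¹ - offspringGFDeriv P V x / offspringGF P V xc) (Set.Iic xc) xc :=
    (continuousWithinAt_id.inv₀ hxc.ne').sub
      ((continuousOn_offspringGFDeriv hm hV hc.integrable_mul_exp xc Set.self_mem_Iic).div_const _)
  have hval : xc⁻¹ - offspringGFDeriv P V xc / offspringGF P V xc = 0 := by
    rw [← hc.eq]
    have := hc.deriv_pos
    field_simp
    ring
  have hev : ∀ᶠ x in 𝓝[<] xc, x⁻¹ - offspringGFDeriv P V x / offspringGF P V xc < ε := by
    have := (hcont.mono Set.Iio_subset_Iic_self).tendsto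
    rw [hval] at this
    exact this.eventually_lt_const hε
  have hev2 : ∀ᶠ x in 𝓝[<] xc, x ∈ Set.Ioo 0 xc := Ioo_mem_nhdsLT hxc
  obtain ⟨x, hx1, hx⟩ := (hev.and hev2).exists
  refine ⟨x, hx, ?_⟩
  have hix := integrable_exp_of_le hm hV hx.2.le hc.integrable_exp
  have hfx := offspringGF_pos hix
  have ht := tangent_lt_offspringGF hV hx.2.ne' hc.integrable_exp hix
    (integrable_mul_exp_of_le hm hV hx.2.le hc.integrable_mul_exp)
  have h1 : Real.log xc - Real.log x ≤ x⁻¹ * (xc - x) := by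
    rw [← Real.log_div hxc.ne' hx.1.ne']
    have := Real.log_le_sub_one_of_pos (div_pos hxc hx.1)
    refine this.trans (le_of_eq ?_)
    have := hx.1.ne'
    field_simp
  have h2 : Real.log (offspringGF P V x) - Real.log (offspringGF P V xc) ≤
      -(offspringGFDeriv P V x / offspringGF P V xc * (xc - x)) := by
    rw [← Real.log_div hfx.ne' hfc.ne']
    have := Real.log_le_sub_one_of_pos (div_pos hfx hfc)
    refine this.trans ?_
    rw [div_sub_one hfc.ne', div_mul_eq_mul_div, ← neg_div]
    gcongr
    linarith
  unfold rootParam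
  nlinarith [mul_lt_mul_of_pos_right hx1 (sub_pos.2 hx.2)]

/-- The derivative of `T` takes every positive value `r` on `(0, x_c)`: `T(x) - r x` attains its
maximum over `(0, x_c]` away from `0`, where `T → -∞`, and away from `x_c`, where `T` is flat. -/
lemma IsCritical.exists_hasDerivAt_rootParam {xc : ℝ} (hc : IsCritical P V xc)
    (hm : AEMeasurable V P) (hV : ∀ᵐ ω ∂P, 0 < V ω) {r : ℝ} (hr : 0 < r) :
    ∃ x ∈ Set.Ioo 0 xc, HasDerivAt (rootParam P V) r x := by
  have hxc : 0 < xc := by linarith [hc.one_lt]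
  set K : ℝ → ℝ := fun x => rootParam P V x - r * x with hK
  have hKc : ContinuousOn K (Set.Ioc 0 xc) := (hc.continuousOn_rootParam hm hV).sub (by fun_prop)
  -- below `z` the function is smaller than its value at `xc`
  set z := min xc (Real.exp (K xc + Real.log (offspringGF P V 0))) with hz
  have hz0 : 0 < z := lt_min hxc (Real.exp_pos _)
  have hzc : z ≤ xc := min_le_left _ _
  have hlow : ∀ x ∈ Set.Ioc 0 xc, x ≤ z → K x ≤ K xc := by
    intro x hx hxz
    have h1 := hc.rootParam_le_log_sub hm hV hx
    have h2 : Real.log x ≤ K xc + Real.log (offspringGF P V 0) := by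
      rw [Real.log_le_iff_le_exp hx.1]; exact hxz.trans (min_le_right _ _)
    have h3 : 0 < r * x := mul_pos hr hx.1
    have h4 : K x = rootParam P V x - r * x := rfl
    linarith
  have hsub : Set.Icc z xc ⊆ Set.Ioc 0 xc := fun x hx => ⟨hz0.trans_le hx.1, hx.2⟩
  obtain ⟨x, hx, hxmax⟩ := isCompact_Icc.exists_isMaxOn ⟨xc, hzc, le_rfl⟩ (hKc.mono hsub)
  have hxm := hsub hx
  have hmax : ∀ x' ∈ Set.Ioc 0 xc, K x' ≤ K x := by
    intro x' hx'
    rcases le_total x' z with h | h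
    · exact (hlow x' hx' h).trans (hxmax ⟨hzc, le_rfl⟩)
    · exact hxmax ⟨h, hx'.2⟩
  have hlt : x < xc := by
    refine lt_of_le_of_ne hxm.2 fun he => ?_
    obtain ⟨w, hw, hwlt⟩ := hc.exists_rootParam_sub_lt hm hV hr
    have h1 := hmax w ⟨hw.1, hw.2.le⟩
    rw [he] at h1
    simp only [hK] at h1
    linarith
  have hd := hc.hasDerivAt_rootParam hm hV ⟨hxm.1, hlt⟩
  have hKd := hd.sub ((hasDerivAt_id x).const_mul r)
  have hloc : IsLocalMax K x := by
    filter_upwards [Ioo_mem_nhds hxm.1 hlt] with w hw using hmax w ⟨hw.1, hw.2.le⟩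
  have h0 := hloc.hasDerivAt_eq_zero hKd
  have hr' : r = x⁻¹ - offspringGFDeriv P V x / offspringGF P V x := by linarith
  exact ⟨x, ⟨hxm.1, hlt⟩, hr' ▸ hd⟩

end Offspring

section Existence

variable {Ω : Type*} [MeasurableSpace Ω] {P : Measure Ω} {V : Ω → ℝ}

lemma lintegral_exp_le_iff (hm : AEMeasurable V P) (x : ℝ) {r : ℝ} (hr : 0 ≤ r) :
    ∫⁻ ω, ENNReal.ofReal (Real.exp (V ω * (x - 1))) ∂P ≤ ENNReal.ofReal r ↔
      Integrable (fun ω => Real.exp (V ω * (x - 1))) P ∧ offspringGF P V x ≤ r := by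
  have hmeas : AEStronglyMeasurable (fun ω => Real.exp (V ω * (x - 1))) P := by fun_prop
  have hnn : 0 ≤ᵐ[P] fun ω => Real.exp (V ω * (x - 1)) := ae_of_all _ fun _ => (Real.exp_pos _).le
  constructor
  · intro h
    have hi : Integrable (fun ω => Real.exp (V ω * (x - 1))) P :=
      ⟨hmeas, (hasFiniteIntegral_iff_ofReal hnn).2 (h.trans_lt ENNReal.ofReal_lt_top)⟩
    refine ⟨hi, ?_⟩
    rwa [← ofReal_integral_eq_lintegral_ofReal hi hnn, ENNReal.ofReal_le_ofReal_iff hr] at h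
  · rintro ⟨hi, h⟩
    rw [← ofReal_integral_eq_lintegral_ofReal hi hnn]
    exact ENNReal.ofReal_le_ofReal h

/-- By Fatou's lemma the set where `f(x) ≤ x` is closed, including at the boundary of the domain
of `f`. -/
lemma isClosed_offspringGF_le (hm : AEMeasurable V P) :
    IsClosed {x : ℝ | 1 ≤ x ∧ Integrable (fun ω => Real.exp (V ω * (x - 1))) P ∧
      offspringGF P V x ≤ x} := by
  refine IsSeqClosed.isClosed fun u x hu hux => ?_
  have hx1 : 1 ≤ x := ge_of_tendsto' hux fun n => (hu n).1
  refine ⟨hx1, (lintegral_exp_le_iff hm x (by linarith)).1 ?_⟩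
  calc ∫⁻ ω, ENNReal.ofReal (Real.exp (V ω * (x - 1))) ∂P
      = ∫⁻ ω, liminf (fun n => ENNReal.ofReal (Real.exp (V ω * (u n - 1)))) atTop ∂P := by
        refine lintegral_congr fun ω => (Tendsto.liminf_eq ?_).symm
        refine ENNReal.tendsto_ofReal ((Real.continuous_exp.tendsto _).comp ?_)
        exact (hux.sub_const 1).const_mul _
    _ ≤ liminf (fun n => ∫⁻ ω, ENNReal.ofReal (Real.exp (V ω * (u n - 1))) ∂P) atTop :=
        lintegral_liminf_le' fun n => by fun_prop
    _ ≤ liminf (fun n => ENNReal.ofReal (u n)) atTop :=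
        liminf_le_liminf (Eventually.of_forall fun n =>
          (lintegral_exp_le_iff hm (u n) (by linarith [(hu n).1])).2 (hu n).2)
    _ = ENNReal.ofReal x := (ENNReal.tendsto_ofReal hux).liminf_eq

/-- Since `V > 0` almost surely, `f` grows at least quadratically. -/
lemma bddAbove_offspringGF_le [IsProbabilityMeasure P] (hm : AEMeasurable V P)
    (hV : ∀ᵐ ω ∂P, 0 < V ω) :
    BddAbove {x : ℝ | 1 ≤ x ∧ Integrable (fun ω => Real.exp (V ω * (x - 1))) P ∧
      offspringGF P V x ≤ x} := by
  have hqi : Integrable (fun ω => (min (V ω) 1) ^ 2) P := by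
    refine (integrable_const (1 : ℝ)).mono' (by fun_prop) ?_
    filter_upwards [hV] with ω hω
    have h0 : 0 ≤ min (V ω) 1 := le_min hω.le zero_le_one
    rw [Real.norm_of_nonneg (by positivity)]
    exact pow_le_one₀ h0 (min_le_right _ _)
  set q := ∫ ω, (min (V ω) 1) ^ 2 ∂P with hq
  have hq0 : 0 < q := integral_pos_of_ae_pos hqi (hV.mono fun ω hω => by
    have : 0 < min (V ω) 1 := lt_min hω one_pos
    positivity)
  refine ⟨2 + 4 / q, fun x ⟨hx1, hxi, hx⟩ => ?_⟩
  have hlow : (x - 1) ^ 2 / 2 * q ≤ x := by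
    refine le_trans ?_ hx
    rw [hq, ← integral_const_mul]
    refine integral_mono_ae (hqi.const_mul _) hxi ?_
    filter_upwards [hV] with ω hω
    have h1 : 0 ≤ min (V ω) 1 := le_min hω.le zero_le_one
    have h2 : min (V ω) 1 * (x - 1) ≤ V ω * (x - 1) :=
      mul_le_mul_of_nonneg_right (min_le_left _ _) (by linarith)
    have h3 := Real.quadratic_le_exp_of_nonneg (mul_nonneg h1 (by linarith : 0 ≤ x - 1))
    have h4 := Real.exp_le_exp.2 h2
    have h5 := mul_nonneg h1 (by linarith : 0 ≤ x - 1)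
    nlinarith
  by_contra hcon
  have hcon : 2 + 4 / q < x := not_le.1 hcon
  have h4 : 0 < 4 / q := by positivity
  have h5 : 4 < (x - 1) * q := by rw [← div_lt_iff₀ hq0]; linarith
  nlinarith

/-- If the domain of finiteness of `f` is open to the right, `f(x) / x` attains an interior minimum
on `x > 1`, and this minimum is a critical point. -/
lemma exists_isCritical [IsProbabilityMeasure P] (hV : ∀ᵐ ω ∂P, 0 < V ω) (hVi : Integrable V P)
    (hsub : ∫ ω, V ω ∂P < 1)
    (hopen : ∀ x, Integrable (fun ω => Real.exp (V ω * (x - 1))) P →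
      ∃ y, x < y ∧ Integrable (fun ω => Real.exp (V ω * (y - 1))) P) :
    ∃ xc, IsCritical P V xc := by
  have hm := hVi.aemeasurable
  set K := {x : ℝ | 1 ≤ x ∧ Integrable (fun ω => Real.exp (V ω * (x - 1))) P ∧
      offspringGF P V x ≤ x} with hKdef
  have hK : IsCompact K := Metric.isCompact_of_isClosed_isBounded (isClosed_offspringGF_le hm)
    ((bddAbove_offspringGF_le hm hV).isBounded ⟨1, fun x hx => hx.1⟩)
  have h1 : (1 : ℝ) ∈ K := ⟨le_rfl, by simp, offspringGF_one.le⟩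
  have hderiv : ∀ x, Integrable (fun ω => Real.exp (V ω * (x - 1))) P →
      HasDerivAt (offspringGF P V) (offspringGFDeriv P V x) x := fun x hx => by
    obtain ⟨y, hxy, hy⟩ := hopen x hx
    exact hasDerivAt_offspringGF hm hV hxy hy
  obtain ⟨x, hxK, hxmin⟩ := hK.exists_isMinOn (f := fun x => offspringGF P V x / x) ⟨1, h1⟩
    (fun z hz => (((hderiv z hz.2.1).continuousAt).div continuousAt_id
      (zero_lt_one.trans_le hz.1).ne').continuousWithinAt)
  -- `f'(1) = E[V] < 1`, so `f(w) < w` for some `w > 1`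
  obtain ⟨w, hwK, hw⟩ : ∃ w ∈ K, offspringGF P V w / w < 1 := by
    obtain ⟨y, hy1, hyi⟩ := hopen 1 (by simp)
    obtain ⟨y', hy'1, hy'⟩ := exists_between hy1
    have hyd := integrable_mul_exp_of_lt hm hV hy' hyi
    have hcont := (continuousOn_offspringGFDeriv hm hV hyd).continuousAt (Iic_mem_nhds hy'1)
    have hval : offspringGFDeriv P V 1 < 1 := by simpa [offspringGFDeriv] using hsub
    have hev : ∀ᶠ z in 𝓝[>] (1 : ℝ), offspringGFDeriv P V z < 1 :=
      (hcont.eventually_lt_const hval).filter_mono nhdsWithin_le_nhds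
    obtain ⟨z, hz1, hz⟩ := (hev.and (Ioo_mem_nhdsGT hy'1)).exists
    have hzi := integrable_exp_of_le hm hV (hz.2.trans hy').le hyi
    have ht := tangent_lt_offspringGF hV hz.1.ne (by simp) hzi
      (integrable_mul_exp_of_le hm hV hz.2.le hyd)
    rw [offspringGF_one] at ht
    have hlt : offspringGF P V z < z := by nlinarith [hz.1]
    exact ⟨z, ⟨hz.1.le, hzi, hlt.le⟩, (div_lt_one (by linarith [hz.1])).2 hlt⟩
  have hxlt : offspringGF P V x / x < 1 := lt_of_le_of_lt (hxmin hwK) hw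
  have hx1 : 1 < x := by
    refine lt_of_le_of_ne hxK.1 fun h => ?_
    rw [← h, offspringGF_one] at hxlt
    simp at hxlt
  have hx0 : x ≠ 0 := by linarith
  obtain ⟨y, hxy, hy⟩ := hopen x hxK.2.1
  have hloc : IsLocalMin (fun x => offspringGF P V x / x) x := by
    filter_upwards [Ioo_mem_nhds hx1 hxy] with z hz
    by_cases hzK : z ∈ K
    · exact hxmin hzK
    · have : ¬ offspringGF P V z ≤ z := fun h =>
        hzK ⟨hz.1.le, integrable_exp_of_le hm hV hz.2.le hy, h⟩
      refine hxlt.le.trans ?_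
      rw [one_le_div (by linarith [hz.1])]
      exact (not_le.1 this).le
  have h0 := hloc.hasDerivAt_eq_zero ((hderiv x hxK.2.1).div (hasDerivAt_id x) hx0)
  refine ⟨x, hx1, hxK.2.1, integrable_mul_exp_of_lt hm hV hxy hy, ?_⟩
  rw [div_eq_zero_iff] at h0
  rcases h0 with h0 | h0
  · show x * offspringGFDeriv P V x = offspringGF P V x
    simp only [mul_one] at h0; linarith
  · exact absurd h0 (pow_ne_zero 2 hx0)

end Existence

/-! ### The cluster recursion -/

section Cluster

/-- The generating function `u_n = E[e^{θ S_n}]` of the number `S_n` of points born during the first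
`n` time units in a cluster of the Hawkes process, for offspring generating function `f` and
normalized exciting function `w`: `u_0 = 1` and
`u_{n+1} = e^θ f(1 + ∑_{s ≤ n} w(s) (u_{n-s} - 1))`. -/
def clusterGF (f : ℝ → ℝ) (w : ℕ → ℝ) (θ : ℝ) : ℕ → ℝ
  | 0 => 1
  | n + 1 => Real.exp θ * f (1 + ∑ s ∈ Finset.range (n + 1), w s * (clusterGF f w θ (n - s) - 1))
decreasing_by omega

/-- The point `1 + ∑_{s ≤ n} w(s) (u_{n-s} - 1)` at which `f` is evaluated in the cluster
recursion. -/
def clusterArg (f : ℝ → ℝ) (w : ℕ → ℝ) (θ : ℝ) (n : ℕ) : ℝ :=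
  1 + ∑ s ∈ Finset.range (n + 1), w s * (clusterGF f w θ (n - s) - 1)

variable {f : ℝ → ℝ} {w : ℕ → ℝ} {θ : ℝ}

lemma clusterGF_zero : clusterGF f w θ 0 = 1 := by rw [clusterGF]

lemma clusterGF_succ (n : ℕ) :
    clusterGF f w θ (n + 1) = Real.exp θ * f (clusterArg f w θ n) := by
  rw [clusterGF, clusterArg]

lemma sum_range_le_one (hw : ∀ s, 0 ≤ w s) (hw1 : HasSum w 1) (n : ℕ) :
    ∑ s ∈ Finset.range n, w s ≤ 1 := sum_le_hasSum _ (fun s _ => hw s) hw1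

lemma clusterArg_le_of_le (hw : ∀ s, 0 ≤ w s) (hw1 : HasSum w 1) {n : ℕ} {x : ℝ} (hx : 1 ≤ x)
    (h : ∀ k ≤ n, clusterGF f w θ k ≤ x) : clusterArg f w θ n ≤ x := by
  have h1 : ∑ s ∈ Finset.range (n + 1), w s * (clusterGF f w θ (n - s) - 1) ≤
      ∑ s ∈ Finset.range (n + 1), w s * (x - 1) :=
    Finset.sum_le_sum fun s _ => mul_le_mul_of_nonneg_left
      (by linarith [h (n - s) (Nat.sub_le _ _)]) (hw s)
  rw [← Finset.sum_mul] at h1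
  have h2 := mul_le_mul_of_nonneg_right (sum_range_le_one hw hw1 (n + 1)) (by linarith : 0 ≤ x - 1)
  unfold clusterArg
  linarith

/-- The summand `s = n + 1` vanishes because `u_0 = 1`. -/
lemma clusterArg_succ (n : ℕ) : clusterArg f w θ (n + 1) =
    1 + ∑ s ∈ Finset.range (n + 1), w s * (clusterGF f w θ (n - s + 1) - 1) := by
  unfold clusterArg
  rw [Finset.sum_range_succ _ (n + 1)]
  simp only [Nat.sub_self, clusterGF_zero, sub_self, mul_zero, add_zero]
  congr 1
  refine Finset.sum_congr rfl fun s hs => ?_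
  rw [Nat.sub_add_comm (Nat.lt_succ_iff.1 (Finset.mem_range.1 hs))]

lemma clusterArg_le_succ (hw : ∀ s, 0 ≤ w s) {n : ℕ}
    (h : ∀ k ≤ n, clusterGF f w θ k ≤ clusterGF f w θ (k + 1)) :
    clusterArg f w θ n ≤ clusterArg f w θ (n + 1) := by
  rw [clusterArg_succ, clusterArg]
  gcongr with s hs
  · exact hw s
  · exact h _ (Nat.sub_le _ _)

lemma clusterArg_succ_le (hw : ∀ s, 0 ≤ w s) {n : ℕ}
    (h : ∀ k ≤ n, clusterGF f w θ (k + 1) ≤ clusterGF f w θ k) :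
    clusterArg f w θ (n + 1) ≤ clusterArg f w θ n := by
  rw [clusterArg_succ, clusterArg]
  gcongr with s hs
  · exact hw s
  · exact h _ (Nat.sub_le _ _)

lemma tendsto_clusterArg (hw : ∀ s, 0 ≤ w s) (hw1 : HasSum w 1) {L : ℝ}
    (h : Tendsto (clusterGF f w θ) atTop (𝓝 L)) :
    Tendsto (clusterArg f w θ) atTop (𝓝 L) := by
  obtain ⟨C, hC⟩ := (h.sub_const 1).norm.bddAbove_range
  have key := tendsto_tsum_of_dominated_convergence (𝓕 := atTop)
    (f := fun n s => if s < n + 1 then w s * (clusterGF f w θ (n - s) - 1) else 0)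
    (g := fun s => w s * (L - 1)) (bound := fun s => C * w s) (hw1.summable.mul_left C)
    (fun s => by
      have h1 : Tendsto (fun n => w s * (clusterGF f w θ (n - s) - 1)) atTop (𝓝 (w s * (L - 1))) :=
        ((h.comp (tendsto_sub_atTop_nat s)).sub_const 1).const_mul _
      refine h1.congr' ?_
      filter_upwards [eventually_ge_atTop s] with n hn
      rw [if_pos (Nat.lt_succ_of_le hn)])
    (Eventually.of_forall fun n s => by
      have hCn : ∀ k, ‖clusterGF f w θ k - 1‖ ≤ C := fun k => hC ⟨k, rfl⟩
      have hC0 : 0 ≤ C := (norm_nonneg _).trans (hCn 0)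
      split_ifs
      · rw [norm_mul, Real.norm_of_nonneg (hw s), mul_comm]
        exact mul_le_mul_of_nonneg_right (hCn _) (hw s)
      · rw [norm_zero]; exact mul_nonneg hC0 (hw s))
  rw [tsum_mul_right, hw1.tsum_eq, one_mul] at key
  have h2 := key.const_add 1
  rw [add_sub_cancel] at h2
  refine h2.congr fun n => ?_
  rw [clusterArg, tsum_eq_sum (s := Finset.range (n + 1))]
  · congr 1
    exact Finset.sum_congr rfl fun s hs => if_pos (Finset.mem_range.1 hs)
  · intro s hs
    exact if_neg fun h => hs (Finset.mem_range.2 h)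

/-- The cluster generating functions stay in the domain of `f`, and converge to the only solution of
`x = e^θ f(x)` in `(0, x_c]`: they are increasing in `n` for `θ ≥ 0` and decreasing for `θ ≤ 0`. -/
lemma tendsto_clusterGF (hw : ∀ s, 0 ≤ w s) (hw1 : HasSum w 1) {xc x : ℝ} (hxc : 1 < xc)
    (hmono : MonotoneOn f (Set.Iic xc)) (hcont : ContinuousOn f (Set.Iic xc)) (hf1 : f 1 = 1)
    (hpos : ∀ y ≤ xc, 0 < f y) (hx : x ∈ Set.Ioc 0 xc) (hfx : x = Real.exp θ * f x)
    (huniq : ∀ y ∈ Set.Ioc 0 xc, y = Real.exp θ * f y → y = x) (hθx : 0 ≤ θ → 1 ≤ x) :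
    (∀ n, clusterArg f w θ n ≤ xc) ∧ Tendsto (clusterGF f w θ) atTop (𝓝 x) := by
  -- a limit in the domain is the fixed point
  have hlim : ∀ L, Tendsto (clusterGF f w θ) atTop (𝓝 L) → (∀ n, clusterArg f w θ n ≤ xc) →
      L = x := by
    intro L hL hle
    have h1 := tendsto_clusterArg hw hw1 hL
    have hLc : L ≤ xc := le_of_tendsto' h1 hle
    have h2 : Tendsto (fun n => f (clusterArg f w θ n)) atTop (𝓝 (f L)) :=
      (hcont L hLc).tendsto.comp (tendsto_nhdsWithin_iff.2 ⟨h1, Eventually.of_forall hle⟩)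
    have h3 : L = Real.exp θ * f L := by
      refine tendsto_nhds_unique ((tendsto_add_atTop_iff_nat 1).2 hL) ?_
      simp only [clusterGF_succ]
      exact h2.const_mul _
    exact huniq L ⟨by rw [h3]; exact mul_pos (Real.exp_pos _) (hpos L hLc), hLc⟩ h3
  rcases le_total 0 θ with hθ | hθ
  · have h1x := hθx hθ
    have hle : ∀ n, clusterGF f w θ n ≤ x := by
      intro n
      induction n using Nat.strong_induction_on with
      | _ n ih =>
        rcases n with _ | n
        · rw [clusterGF_zero]; exact h1x
        · have ha := clusterArg_le_of_le hw hw1 h1x fun k hk => ih k (Nat.lt_succ_of_le hk)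
          rw [clusterGF_succ]
          refine le_trans ?_ hfx.ge
          exact mul_le_mul_of_nonneg_left (hmono (ha.trans hx.2) hx.2 ha) (Real.exp_pos _).le
    have harg : ∀ n, clusterArg f w θ n ≤ xc := fun n =>
      (clusterArg_le_of_le hw hw1 h1x fun k _ => hle k).trans hx.2
    have hstep : ∀ n, clusterGF f w θ n ≤ clusterGF f w θ (n + 1) := by
      intro n
      induction n using Nat.strong_induction_on with
      | _ n ih =>
        rcases n with _ | n
        · have h0 : clusterArg f w θ 0 = 1 := by simp [clusterArg, clusterGF_zero]
          rw [clusterGF_succ, clusterGF_zero, h0, hf1, mul_one]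
          exact Real.one_le_exp hθ
        · rw [clusterGF_succ, clusterGF_succ]
          exact mul_le_mul_of_nonneg_left (hmono (harg _) (harg _)
            (clusterArg_le_succ hw fun k hk => ih k (Nat.lt_succ_of_le hk))) (Real.exp_pos _).le
    have hL := tendsto_atTop_ciSup (monotone_nat_of_le_succ hstep)
      ⟨x, by rintro _ ⟨n, rfl⟩; exact hle n⟩
    rw [hlim _ hL harg] at hL
    exact ⟨harg, hL⟩
  · have hle : ∀ n, clusterGF f w θ n ≤ 1 := by
      intro n
      induction n using Nat.strong_induction_on with
      | _ n ih =>
        rcases n with _ | n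
        · rw [clusterGF_zero]
        · have ha := clusterArg_le_of_le hw hw1 le_rfl fun k hk => ih k (Nat.lt_succ_of_le hk)
          have h1 : f (clusterArg f w θ n) ≤ 1 := by
            rw [← hf1]; exact hmono (ha.trans hxc.le) hxc.le ha
          rw [clusterGF_succ]
          exact mul_le_one₀ (Real.exp_le_one_iff.2 hθ) (hpos _ (ha.trans hxc.le)).le h1
    have harg : ∀ n, clusterArg f w θ n ≤ xc := fun n =>
      (clusterArg_le_of_le hw hw1 le_rfl fun k _ => hle k).trans hxc.le
    have hstep : ∀ n, clusterGF f w θ (n + 1) ≤ clusterGF f w θ n := by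
      intro n
      induction n using Nat.strong_induction_on with
      | _ n ih =>
        rcases n with _ | n
        · rw [clusterGF_zero]; exact hle 1
        · rw [clusterGF_succ, clusterGF_succ]
          exact mul_le_mul_of_nonneg_left (hmono (harg _) (harg _)
            (clusterArg_succ_le hw fun k hk => ih k (Nat.lt_succ_of_le hk))) (Real.exp_pos _).le
    have hnn : ∀ n, 0 ≤ clusterGF f w θ n := by
      rintro (_ | n)
      · rw [clusterGF_zero]; exact zero_le_one
      · rw [clusterGF_succ]; exact (mul_pos (Real.exp_pos _) (hpos _ (harg n))).le
    have hL := tendsto_atTop_ciInf (antitone_nat_of_succ_le hstep)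
      ⟨0, by rintro _ ⟨n, rfl⟩; exact hnn n⟩
    rw [hlim _ hL harg] at hL
    exact ⟨harg, hL⟩

end Cluster

/-! ### The moment generating function of the counts -/

section CondExp

variable {Ω : Type*} {m m0 : MeasurableSpace Ω} {P : Measure Ω} [IsProbabilityMeasure P]

/-- If `p` is the conditional probability of `B` given `m`, integrals over `B` of nonnegative
`m`-measurable functions are integrals against the density `p`. -/
lemma setLIntegral_eq_lintegral_mul_condProb (hm : m ≤ m0) {B : Set Ω} (hB : MeasurableSet[m0] B)
    {p : Ω → ℝ} (hp : Measurable[m0] p) (h : P[B.indicator (fun _ => (1 : ℝ)) | m] =ᵐ[P] p)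
    {G : Ω → ENNReal} (hG : Measurable[m] G) :
    ∫⁻ ω in B, G ω ∂P = ∫⁻ ω, G ω * ENNReal.ofReal (p ω) ∂P := by
  have hind : Integrable (B.indicator (fun _ => (1 : ℝ))) P :=
    (integrable_const (1 : ℝ)).indicator hB
  have hpi : Integrable p P := integrable_condExp.congr h
  have hp0 : 0 ≤ᵐ[P] p := by
    have h1 : 0 ≤ᵐ[P] P[B.indicator (fun _ => (1 : ℝ)) | m] :=
      condExp_nonneg (ae_of_all _ fun ω => Set.indicator_nonneg (fun _ _ => zero_le_one) ω)
    filter_upwards [h1, h] with ω h1 h2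
    rwa [← h2]
  have heq : (P.restrict B).trim hm = (P.withDensity fun ω => ENNReal.ofReal (p ω)).trim hm := by
    refine @Measure.ext _ m _ _ fun s hs => ?_
    rw [trim_measurableSet_eq hm hs, trim_measurableSet_eq hm hs,
      withDensity_apply _ (hm s hs), Measure.restrict_apply (hm s hs),
      ← ofReal_integral_eq_lintegral_ofReal hpi.integrableOn (ae_restrict_of_ae hp0),
      ← setIntegral_congr_ae (hm s hs) (h.mono fun _ h _ => h), setIntegral_condExp hm hind hs,
      integral_indicator_const _ hB]
    simp [measureReal_def, Measure.restrict_apply hB, Set.inter_comm]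
  rw [← lintegral_trim hm hG, heq, lintegral_trim hm hG,
    lintegral_withDensity_eq_lintegral_mul _ hp.ennreal_ofReal (hG.mono hm le_rfl)]
  simp only [Pi.mul_apply, mul_comm]

end CondExp

section Counts

variable {Ω : Type*} {ν : ℝ} {α : ℕ → ℝ} {ℓ : ℕ → ℕ → Ω → ℝ} {Z : ℕ → Ω → ℕ}

lemma measurable_count_history {s t : ℕ} (hs : 1 ≤ s) (hst : s < t) :
    Measurable[history ℓ Z t] (Z s) :=
  measurable_iff_comap_le.2 (le_sup_left.trans
    (le_iSup₂ (f := fun s (_ : s ∈ Set.Ico 1 t) => MeasurableSpace.comap (Z s) inferInstance ⊔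
      MeasurableSpace.comap (compoundMark ℓ Z s) inferInstance) s ⟨hs, hst⟩))

lemma measurable_compoundMark_history {s t : ℕ} (hs : 1 ≤ s) (hst : s < t) :
    Measurable[history ℓ Z t] (compoundMark ℓ Z s) :=
  measurable_iff_comap_le.2 (le_sup_right.trans
    (le_iSup₂ (f := fun s (_ : s ∈ Set.Ico 1 t) => MeasurableSpace.comap (Z s) inferInstance ⊔
      MeasurableSpace.comap (compoundMark ℓ Z s) inferInstance) s ⟨hs, hst⟩))

lemma measurable_intensity_history (t : ℕ) :
    Measurable[history ℓ Z t] (intensity ν α ℓ Z t) := by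
  refine measurable_const.add (Finset.measurable_sum _ fun s hs => ?_)
  have := Finset.mem_Ico.1 hs
  exact (measurable_compoundMark_history (by omega) (by omega)).const_mul _

variable [MeasurableSpace Ω] {P : Measure Ω}

lemma IsMarkedHawkes.measurable_compoundMark (hZ : IsMarkedHawkes P ν α ℓ Z) {t : ℕ} (ht : 1 ≤ t) :
    Measurable (compoundMark ℓ Z t) := by
  have h : Measurable (fun p : ℕ × Ω => ∑ j ∈ Finset.Icc 1 p.1, ℓ t j p.2) :=
    measurable_from_prod_countable_right fun n =>
      Finset.measurable_sum _ fun j hj => hZ.measurable_mark t j ht (Finset.mem_Icc.1 hj).1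
  exact h.comp ((hZ.measurable_count t ht).prodMk measurable_id)

lemma IsMarkedHawkes.history_le (hZ : IsMarkedHawkes P ν α ℓ Z) (t : ℕ) :
    history ℓ Z t ≤ (inferInstance : MeasurableSpace Ω) :=
  iSup₂_le fun s hs => sup_le (hZ.measurable_count s hs.1).comap_le
    (hZ.measurable_compoundMark hs.1).comap_le

lemma IsMarkedHawkes.intensity_nonneg (hZ : IsMarkedHawkes P ν α ℓ Z) (hν : 0 < ν)
    (hα : ∀ t, 1 ≤ t → 0 ≤ α t) (t : ℕ) : ∀ᵐ ω ∂P, 0 ≤ intensity ν α ℓ Z t ω := by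
  have h : ∀ᵐ ω ∂P, ∀ t j, 1 ≤ t → 1 ≤ j → 0 < ℓ t j ω := by
    simp only [ae_all_iff]
    exact fun t j ht hj => hZ.mark_pos t j ht hj
  filter_upwards [h] with ω hω
  refine add_nonneg hν.le (Finset.sum_nonneg fun s hs => mul_nonneg (hα s (Finset.mem_Ico.1 hs).1)
    (Finset.sum_nonneg fun j hj => ?_))
  have := Finset.mem_Ico.1 hs
  exact (hω (t - s) j (by omega) (Finset.mem_Icc.1 hj).1).le

lemma IsMarkedHawkes.lintegral_exp_sum_mark (hZ : IsMarkedHawkes P ν α ℓ Z) {t : ℕ} (ht : 1 ≤ t)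
    (c : ℝ) (k : ℕ) :
    ∫⁻ ω, ENNReal.ofReal (Real.exp (c * ∑ j ∈ Finset.Icc 1 k, ℓ t j ω)) ∂P =
      (∫⁻ ω, ENNReal.ofReal (Real.exp (c * ℓ 1 1 ω)) ∂P) ^ k := by
  set g : ℝ → ENNReal := fun y => ENNReal.ofReal (Real.exp (c * y)) with hg
  have hgm : Measurable g := by fun_prop
  have hind : iIndepFun (fun j : ℕ => ℓ t (j + 1)) P := by
    have := hZ.mark_iIndep.precomp (g := fun j : ℕ => (t - 1, j)) fun i j h => (Prod.mk.inj h).2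
    simpa [Nat.sub_add_cancel ht] using this
  have hind2 := hind.comp (fun _ => g) fun _ => hgm
  have h1 : ∀ ω, ENNReal.ofReal (Real.exp (c * ∑ j ∈ Finset.Icc 1 k, ℓ t j ω)) =
      ∏ j ∈ Finset.range k, (g ∘ ℓ t (j + 1)) ω := by
    intro ω
    rw [Finset.range_eq_Ico, Finset.prod_Ico_add' (fun j => (g ∘ ℓ t j) ω) 0 k 1, Finset.mul_sum,
      Real.exp_sum, ENNReal.ofReal_prod_of_nonneg fun _ _ => (Real.exp_pos _).le]
    rfl
  rw [lintegral_congr h1, lintegral_prod_eq_prod_lintegral_of_indepFun _ _ hind2 fun j =>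
    hgm.comp (hZ.measurable_mark t (j + 1) ht (by omega))]
  rw [Finset.prod_congr rfl fun j _ =>
    ((hZ.mark_identDistrib t (j + 1) ht (by omega)).comp hgm).lintegral_eq]
  simp [hg]

/-- One step of the backward recursion: integrating out the count and the marks at time `t` given
the history. -/
lemma IsMarkedHawkes.lintegral_mul_exp_step [IsProbabilityMeasure P]
    (hZ : IsMarkedHawkes P ν α ℓ Z) (hν : 0 < ν)
    (hα : ∀ t, 1 ≤ t → 0 ≤ α t) {t : ℕ} (ht : 1 ≤ t) (θ c : ℝ)
    (hc : Integrable (fun ω => Real.exp (c * ℓ 1 1 ω)) P)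
    {G : Ω → ENNReal} (hG : Measurable[history ℓ Z t] G) :
    ∫⁻ ω, G ω * ENNReal.ofReal (Real.exp (θ * Z t ω + c * compoundMark ℓ Z t ω)) ∂P =
      ∫⁻ ω, G ω * ENNReal.ofReal (Real.exp (intensity ν α ℓ Z t ω *
        (Real.exp θ * (∫ ω, Real.exp (c * ℓ 1 1 ω) ∂P) - 1))) ∂P := by
  set M := ∫ ω, Real.exp (c * ℓ 1 1 ω) ∂P with hM
  have hM0 : 0 ≤ M := integral_nonneg fun _ => (Real.exp_pos _).le
  have hle := hZ.history_le t
  have hGm := hG.mono hle le_rfl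
  have hZm := hZ.measurable_count t ht
  have hlam : Measurable (intensity ν α ℓ Z t) := (measurable_intensity_history t).mono hle le_rfl
  have hmarks : (⨆ j ∈ Set.Ici 1, MeasurableSpace.comap (ℓ t j) inferInstance) ≤
      (inferInstance : MeasurableSpace Ω) :=
    iSup₂_le fun j hj => (hZ.measurable_mark t j ht hj).comap_le
  have hBm : ∀ k : ℕ, MeasurableSet (Z t ⁻¹' {k}) := fun k => hZm (measurableSet_singleton k)
  have hslice : ∀ k : ℕ, ∫⁻ ω in Z t ⁻¹' {k},
      G ω * ENNReal.ofReal (Real.exp (θ * Z t ω + c * compoundMark ℓ Z t ω)) ∂P =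
      ∫⁻ ω, G ω * ENNReal.ofReal (Real.exp (-intensity ν α ℓ Z t ω) *
        intensity ν α ℓ Z t ω ^ k / (k.factorial : ℝ)) *
          ENNReal.ofReal ((Real.exp θ * M) ^ k) ∂P := by
    intro k
    have hHm : Measurable[⨆ j ∈ Set.Ici 1, MeasurableSpace.comap (ℓ t j) inferInstance]
        (fun ω => ENNReal.ofReal (Real.exp (c * ∑ j ∈ Finset.Icc 1 k, ℓ t j ω))) := by
      refine ENNReal.measurable_ofReal.comp (Real.measurable_exp.comp
        ((Finset.measurable_sum _ fun j hj => ?_).const_mul c))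
      exact measurable_iff_comap_le.2 (le_iSup₂
        (f := fun j (_ : j ∈ Set.Ici 1) => MeasurableSpace.comap (ℓ t j) inferInstance) j
        (Finset.mem_Icc.1 hj).1)
    have hFm : Measurable[history ℓ Z t ⊔ MeasurableSpace.comap (Z t) inferInstance]
        ((Z t ⁻¹' {k}).indicator G) := by
      refine (hG.mono le_sup_left le_rfl).indicator ?_
      exact (le_sup_right : MeasurableSpace.comap (Z t) inferInstance ≤ _) _
        ⟨{k}, measurableSet_singleton k, rfl⟩
    have hsup : history ℓ Z t ⊔ MeasurableSpace.comap (Z t) inferInstance ≤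
        (inferInstance : MeasurableSpace Ω) := sup_le hle hZm.comap_le
    calc ∫⁻ ω in Z t ⁻¹' {k},
          G ω * ENNReal.ofReal (Real.exp (θ * Z t ω + c * compoundMark ℓ Z t ω)) ∂P
        = ∫⁻ ω in Z t ⁻¹' {k}, ENNReal.ofReal (Real.exp θ ^ k) * (G ω *
            ENNReal.ofReal (Real.exp (c * ∑ j ∈ Finset.Icc 1 k, ℓ t j ω))) ∂P := by
          refine setLIntegral_congr_fun (hBm k) fun ω hω => ?_
          have hk : Z t ω = k := hω
          simp only [compoundMark, hk]
          rw [Real.exp_add, ENNReal.ofReal_mul (Real.exp_pos _).le, ← Real.exp_nat_mul,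
            mul_comm θ]
          ring
      _ = ENNReal.ofReal (Real.exp θ ^ k) * ∫⁻ ω, (Z t ⁻¹' {k}).indicator G ω *
            ENNReal.ofReal (Real.exp (c * ∑ j ∈ Finset.Icc 1 k, ℓ t j ω)) ∂P := by
          rw [lintegral_const_mul' _ _ ENNReal.ofReal_ne_top, ← lintegral_indicator (hBm k)]
          congr 1
          refine lintegral_congr fun ω => ?_
          by_cases hω : ω ∈ Z t ⁻¹' {k} <;> simp [hω]
      _ = ENNReal.ofReal (Real.exp θ ^ k) *
            ((∫⁻ ω, G ω * ENNReal.ofReal (Real.exp (-intensity ν α ℓ Z t ω) *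
              intensity ν α ℓ Z t ω ^ k / (k.factorial : ℝ)) ∂P) * ENNReal.ofReal M ^ k) := by
          rw [lintegral_mul_eq_lintegral_mul_lintegral_of_independent_measurableSpace hsup hmarks
            (hZ.mark_indep t ht).symm hFm hHm, hZ.lintegral_exp_sum_mark ht,
            ← ofReal_integral_eq_lintegral_ofReal hc (ae_of_all _ fun _ => (Real.exp_pos _).le),
            lintegral_indicator (hBm k), setLIntegral_eq_lintegral_mul_condProb hle (hBm k)
              (by fun_prop) (hZ.cond_poisson t ht k) hG]
      _ = _ := by
          rw [lintegral_mul_const' _ _ ENNReal.ofReal_ne_top, mul_pow,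
            ENNReal.ofReal_mul (by positivity), ENNReal.ofReal_pow hM0]
          ring
  have huniv : (⋃ k : ℕ, Z t ⁻¹' {k}) = Set.univ := by
    ext ω; simp
  rw [← setLIntegral_univ, ← huniv, lintegral_iUnion hBm (fun i j hij => by
    refine Disjoint.preimage _ ?_
    simpa using hij), tsum_congr hslice, ← lintegral_tsum fun k => by fun_prop]
  refine lintegral_congr_ae ?_
  filter_upwards [hZ.intensity_nonneg hν hα t] with ω hω
  simp only [mul_assoc]
  rw [ENNReal.tsum_mul_left]
  congr 1
  set lam := intensity ν α ℓ Z t ω with hlamdef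
  have hs : HasSum
      (fun k : ℕ => Real.exp (-lam) * ((lam * (Real.exp θ * M)) ^ k / (k.factorial : ℝ)))
      (Real.exp (-lam) * Real.exp (lam * (Real.exp θ * M))) := by
    rw [Real.exp_eq_exp_ℝ]
    exact (NormedSpace.expSeries_div_hasSum_exp (lam * (NormedSpace.exp θ * M))).mul_left _
  have hnn : ∀ k : ℕ, 0 ≤ Real.exp (-lam) * ((lam * (Real.exp θ * M)) ^ k / (k.factorial : ℝ)) :=
    fun k => by positivity
  rw [mul_sub, mul_one, sub_eq_neg_add, Real.exp_add, ← hs.tsum_eq,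
    ENNReal.ofReal_tsum_of_nonneg hnn hs.summable]
  refine tsum_congr fun k => ?_
  rw [← ENNReal.ofReal_mul (by positivity)]
  congr 1
  rw [mul_pow lam]
  ring

end Counts

section CountMGF

variable {Ω : Type*} [MeasurableSpace Ω] {P : Measure Ω} {ν : ℝ} {α : ℕ → ℝ}
  {ℓ : ℕ → ℕ → Ω → ℝ} {Z : ℕ → Ω → ℕ}

/-- The mean number of offspring of a point with the mark `ℓ 1 1`, namely `‖α‖₁ ℓ`. -/
def meanOffspring (α : ℕ → ℝ) (ℓ : ℕ → ℕ → Ω → ℝ) (ω : Ω) : ℝ := l1Norm α * ℓ 1 1 ω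

/-- The exciting function normalized to a probability distribution on lags; the lag `s + 1` has
index `s`. -/
def lagWeight (α : ℕ → ℝ) (s : ℕ) : ℝ := α (s + 1) / l1Norm α

/-- The cluster generating functions of the marked Hawkes process. -/
def hawkesClusterGF (P : Measure Ω) (α : ℕ → ℝ) (ℓ : ℕ → ℕ → Ω → ℝ) (θ : ℝ) : ℕ → ℝ :=
  clusterGF (offspringGF P (meanOffspring α ℓ)) (lagWeight α) θ

lemma l1Norm_mul_clusterArg_sub_one (hα0 : l1Norm α ≠ 0) (f : ℝ → ℝ) (θ : ℝ) (m : ℕ) :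
    l1Norm α * (clusterArg f (lagWeight α) θ m - 1) =
      ∑ k ∈ Finset.range m, α (m - k) * (clusterGF f (lagWeight α) θ (k + 1) - 1) := by
  rw [clusterArg, add_sub_cancel_left, Finset.sum_range_succ, Nat.sub_self, clusterGF_zero,
    sub_self, mul_zero, add_zero, Finset.mul_sum, ← Finset.sum_range_reflect]
  refine Finset.sum_congr rfl fun k hk => ?_
  have hk := Finset.mem_range.1 hk
  rw [lagWeight, show m - 1 - k + 1 = m - k by omega, show m - (m - 1 - k) = k + 1 by omega]
  field_simp

/-- Backward recursion: integrating out the last `m` time steps replaces the count at these times by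
the contribution of the clusters of the earlier points. -/
lemma IsMarkedHawkes.lintegral_exp_count_add [IsProbabilityMeasure P]
    (hZ : IsMarkedHawkes P ν α ℓ Z) (hν : 0 < ν)
    (hα : ∀ t, 1 ≤ t → 0 ≤ α t) (hα0 : l1Norm α ≠ 0) {θ : ℝ}
    (hint : ∀ n, Integrable (fun ω => Real.exp (meanOffspring α ℓ ω *
      (clusterArg (offspringGF P (meanOffspring α ℓ)) (lagWeight α) θ n - 1))) P) (m : ℕ) :
    ∀ τ : ℕ, ∫⁻ ω, ENNReal.ofReal (Real.exp (θ * count Z (τ + m) ω)) ∂P =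
      ∫⁻ ω, ENNReal.ofReal (Real.exp (θ * count Z τ ω +
        ν * ∑ k ∈ Finset.range m, (hawkesClusterGF P α ℓ θ (k + 1) - 1) +
        ∑ r ∈ Finset.Icc 1 τ, compoundMark ℓ Z r ω * ∑ k ∈ Finset.range m,
          α (τ + m - k - r) * (hawkesClusterGF P α ℓ θ (k + 1) - 1))) ∂P := by
  induction m with
  | zero => intro τ; simp
  | succ m ih =>
    intro τ
    set u := hawkesClusterGF P α ℓ θ with hu
    set c := l1Norm α * (clusterArg (offspringGF P (meanOffspring α ℓ)) (lagWeight α) θ m - 1)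
      with hc
    have hcsum : c = ∑ k ∈ Finset.range m, α (m - k) * (u (k + 1) - 1) :=
      l1Norm_mul_clusterArg_sub_one hα0 _ _ _
    have hexp : (fun ω => Real.exp (c * ℓ 1 1 ω)) = fun ω => Real.exp (meanOffspring α ℓ ω *
        (clusterArg (offspringGF P (meanOffspring α ℓ)) (lagWeight α) θ m - 1)) := by
      funext ω; rw [hc, meanOffspring]; ring_nf
    have husucc : Real.exp θ * (∫ ω, Real.exp (c * ℓ 1 1 ω) ∂P) = u (m + 1) := by
      rw [hexp, hu, hawkesClusterGF, clusterGF_succ]; rfl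
    set G : Ω → ENNReal := fun ω => ENNReal.ofReal (Real.exp (θ * count Z τ ω +
        ν * ∑ k ∈ Finset.range m, (u (k + 1) - 1) +
        ∑ r ∈ Finset.Icc 1 τ, compoundMark ℓ Z r ω * ∑ k ∈ Finset.range m,
          α (τ + 1 + m - k - r) * (u (k + 1) - 1))) with hGdef
    have hG : Measurable[history ℓ Z (τ + 1)] G := by
      have h1 : Measurable[history ℓ Z (τ + 1)] (fun ω => (count Z τ ω : ℝ)) := by
        have : Measurable[history ℓ Z (τ + 1)] (count Z τ) :=
          Finset.measurable_sum _ fun s hs => by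
            have := Finset.mem_Icc.1 hs
            exact measurable_count_history this.1 (by omega)
        exact measurable_from_top.comp this
      refine ENNReal.measurable_ofReal.comp (Real.measurable_exp.comp ?_)
      refine ((h1.const_mul θ).add measurable_const).add (Finset.measurable_sum _ fun r hr => ?_)
      have := Finset.mem_Icc.1 hr
      exact (measurable_compoundMark_history this.1 (by omega)).mul_const _
    have hstep := hZ.lintegral_mul_exp_step hν hα (t := τ + 1) (by omega) θ c
      (by rw [hexp]; exact hint m) hG
    rw [husucc] at hstep
    rw [show τ + (m + 1) = τ + 1 + m by omega, ih (τ + 1)]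
    refine Eq.trans (lintegral_congr fun ω => ?_) (hstep.trans (lintegral_congr fun ω => ?_))
    · rw [hGdef, ← ENNReal.ofReal_mul (Real.exp_pos _).le, ← Real.exp_add]
      congr 2
      have hcount : (count Z (τ + 1) ω : ℝ) = count Z τ ω + Z (τ + 1) ω := by
        rw [count, Finset.sum_Icc_succ_top (by omega), Nat.cast_add]; rfl
      have hcoef : ∑ k ∈ Finset.range m, α (τ + 1 + m - k - (τ + 1)) * (u (k + 1) - 1) = c := by
        rw [hcsum]
        refine Finset.sum_congr rfl fun k _ => ?_
        rw [show τ + 1 + m - k - (τ + 1) = m - k by omega]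
      rw [Finset.sum_Icc_succ_top (by omega), hcoef, hcount]
      ring
    · rw [hGdef, ← ENNReal.ofReal_mul (Real.exp_pos _).le, ← Real.exp_add]
      congr 2
      have hlam : intensity ν α ℓ Z (τ + 1) ω =
          ν + ∑ r ∈ Finset.Icc 1 τ, compoundMark ℓ Z r ω * α (τ + 1 - r) := by
        rw [intensity]
        congr 1
        refine Finset.sum_bij' (fun s _ => τ + 1 - s) (fun r _ => τ + 1 - r) ?_ ?_ ?_ ?_ ?_ <;>
          simp only [Finset.mem_Ico, Finset.mem_Icc]
        · intro s hs; omega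
        · intro r hr; omega
        · intro s hs; omega
        · intro r hr; omega
        · intro s hs
          rw [show τ + 1 - (τ + 1 - s) = s by omega, mul_comm]
      have hcoef : ∀ r ∈ Finset.Icc 1 τ, compoundMark ℓ Z r ω * ∑ k ∈ Finset.range (m + 1),
          α (τ + 1 + m - k - r) * (u (k + 1) - 1) =
          compoundMark ℓ Z r ω * (∑ k ∈ Finset.range m,
          α (τ + 1 + m - k - r) * (u (k + 1) - 1)) +
          compoundMark ℓ Z r ω * α (τ + 1 - r) * (u (m + 1) - 1) := by
        intro r _
        rw [Finset.sum_range_succ, show τ + 1 + m - m - r = τ + 1 - r by omega]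
        ring
      rw [hlam, Finset.sum_congr rfl hcoef, Finset.sum_add_distrib, ← Finset.sum_mul,
        Finset.sum_range_succ]
      ring

/-- `log E[e^{θ N_t}] = ν ∑_{k=1}^t (u_k - 1)`: the clusters of the immigrants are independent, and
the cluster of an immigrant at time `t + 1 - k` has size distributed as `S_k`. -/
lemma IsMarkedHawkes.lintegral_exp_count [IsProbabilityMeasure P]
    (hZ : IsMarkedHawkes P ν α ℓ Z) (hν : 0 < ν)
    (hα : ∀ t, 1 ≤ t → 0 ≤ α t) (hα0 : l1Norm α ≠ 0) {θ : ℝ}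
    (hint : ∀ n, Integrable (fun ω => Real.exp (meanOffspring α ℓ ω *
      (clusterArg (offspringGF P (meanOffspring α ℓ)) (lagWeight α) θ n - 1))) P) (t : ℕ) :
    ∫⁻ ω, ENNReal.ofReal (Real.exp (θ * count Z t ω)) ∂P =
      ENNReal.ofReal (Real.exp
        (ν * ∑ k ∈ Finset.range t, (hawkesClusterGF P α ℓ θ (k + 1) - 1))) := by
  have h := hZ.lintegral_exp_count_add hν hα hα0 hint t 0
  simpa [count] using h

lemma IsMarkedHawkes.measurable_totalCount (hZ : IsMarkedHawkes P ν α ℓ Z) (t : ℕ) :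
    Measurable (count Z t) :=
  Finset.measurable_sum _ fun s hs => hZ.measurable_count s (Finset.mem_Icc.1 hs).1

end CountMGF

/-! ### Large deviation bounds on the line from exponential moments -/

section GartnerEllis

/-- The scaled logarithmic moment generating function `n⁻¹ log ∫ e^{nθy} dμ_n(y)` converges to
`γ`. -/
def HasScaledLogMGF (μ : ℕ → Measure ℝ) (θ γ : ℝ) : Prop :=
  ∃ L : ℕ → ℝ, Tendsto L atTop (𝓝 γ) ∧ ∀ᶠ n in atTop,
    ∫⁻ y, ENNReal.ofReal (Real.exp (n * (θ * y))) ∂(μ n) = ENNReal.ofReal (Real.exp (n * L n))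

lemma inv_mul_log_exp {n : ℕ} (hn : 0 < n) (r : ℝ) :
    (((n : ℝ)⁻¹ : ℝ) : EReal) * ENNReal.log (ENNReal.ofReal (Real.exp (n * r))) = r := by
  rw [ENNReal.log_ofReal_of_pos (Real.exp_pos _), Real.log_exp, ← EReal.coe_mul]
  congr 1
  field_simp

lemma limsup_inv_mul_log_le {p : ℕ → ENNReal} {r : ℝ}
    (h : ∀ᶠ n : ℕ in atTop, p n ≤ ENNReal.ofReal (Real.exp (n * r))) :
    limsup (fun n : ℕ => (((n : ℝ)⁻¹ : ℝ) : EReal) * ENNReal.log (p n)) atTop ≤ r := by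
  refine limsup_le_of_le (h := ?_)
  filter_upwards [h, eventually_gt_atTop 0] with n hn hn0
  rw [← inv_mul_log_exp hn0 r]
  exact mul_le_mul_of_nonneg_left (ENNReal.log_monotone hn) (by
    rw [← EReal.coe_zero, EReal.coe_le_coe_iff]; positivity)

lemma le_liminf_inv_mul_log {p : ℕ → ENNReal} {r : ℝ}
    (h : ∀ᶠ n : ℕ in atTop, ENNReal.ofReal (Real.exp (n * r)) ≤ p n) :
    (r : EReal) ≤ liminf (fun n : ℕ => (((n : ℝ)⁻¹ : ℝ) : EReal) * ENNReal.log (p n)) atTop := by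
  refine le_liminf_of_le (h := ?_)
  filter_upwards [h, eventually_gt_atTop 0] with n hn hn0
  rw [← inv_mul_log_exp hn0 r]
  exact mul_le_mul_of_nonneg_left (ENNReal.log_monotone hn) (by
    rw [← EReal.coe_zero, EReal.coe_le_coe_iff]; positivity)

lemma eventually_le_exp_mul (C : ℝ) {ε : ℝ} (hε : 0 < ε) :
    ∀ᶠ n : ℕ in atTop, C ≤ Real.exp (n * ε) :=
  (Real.tendsto_exp_atTop.comp
    (tendsto_natCast_atTop_atTop.atTop_mul_const hε)).eventually_ge_atTop C

/-- Chernoff bound for a tilted half-line. -/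
lemma setLIntegral_exp_le {μ : Measure ℝ} {B : Set ℝ} (hB : MeasurableSet B) {s θ θ' K : ℝ}
    (h : ∀ y ∈ B, s * (θ * y) ≤ s * (θ' * y) + K) :
    ∫⁻ y in B, ENNReal.ofReal (Real.exp (s * (θ * y))) ∂μ ≤
      ENNReal.ofReal (Real.exp K) * ∫⁻ y, ENNReal.ofReal (Real.exp (s * (θ' * y))) ∂μ := by
  calc ∫⁻ y in B, ENNReal.ofReal (Real.exp (s * (θ * y))) ∂μ
      ≤ ∫⁻ y in B, ENNReal.ofReal (Real.exp K) * ENNReal.ofReal (Real.exp (s * (θ' * y))) ∂μ := by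
        refine setLIntegral_mono' hB fun y hy => ?_
        rw [← ENNReal.ofReal_mul (Real.exp_pos _).le, ← Real.exp_add]
        exact ENNReal.ofReal_le_ofReal (Real.exp_le_exp.2 (by linarith [h y hy]))
    _ ≤ ∫⁻ y, ENNReal.ofReal (Real.exp K) * ENNReal.ofReal (Real.exp (s * (θ' * y))) ∂μ :=
        setLIntegral_le_lintegral _ _
    _ = _ := lintegral_const_mul' _ _ ENNReal.ofReal_ne_top

/-- The upper bound of the Gärtner–Ellis theorem on `ℝ`: a closed set on which the rate exceeds `c`
is covered by finitely many of the half-lines `{y | θ y - Γ(θ) > c}`. Parameters `θ` of both signs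
take care of a neighbourhood of infinity. -/
lemma limsup_le_neg_iInf_closure {μ : ℕ → Measure ℝ} {D : Set ℝ} {Γ : ℝ → ℝ}
    (h : ∀ θ ∈ D, HasScaledLogMGF μ θ (Γ θ)) (hpos : ∃ θ ∈ D, 0 < θ) (hneg : ∃ θ ∈ D, θ < 0)
    (A : Set ℝ) :
    limsup (fun n : ℕ => (((n : ℝ)⁻¹ : ℝ) : EReal) * ENNReal.log (μ n A)) atTop ≤
      -(⨅ x ∈ closure A, ⨆ θ ∈ D, ((θ * x - Γ θ : ℝ) : EReal)) := by
  set J := ⨅ x ∈ closure A, ⨆ θ ∈ D, ((θ * x - Γ θ : ℝ) : EReal) with hJ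
  by_contra hcon
  obtain ⟨b, hb1, hb2⟩ := EReal.lt_iff_exists_real_btwn.1 (not_le.1 hcon)
  obtain ⟨b', hb'1, hb'2⟩ := EReal.lt_iff_exists_real_btwn.1 hb1
  rw [EReal.coe_lt_coe_iff] at hb'2
  set c := -b' with hc
  have hcJ : (c : EReal) < J := by
    rw [hc, EReal.coe_neg]; exact EReal.neg_lt_comm.1 hb'1
  have hcov : ∀ x ∈ closure A, ∃ θ ∈ D, c < θ * x - Γ θ := by
    intro x hx
    have h1 := hcJ.trans_le (iInf₂_le x hx)
    rw [lt_iSup_iff] at h1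
    obtain ⟨θ, h1⟩ := h1
    rw [lt_iSup_iff] at h1
    obtain ⟨hθ, h1⟩ := h1
    exact ⟨θ, hθ, EReal.coe_lt_coe_iff.1 h1⟩
  set H : ℝ → Set ℝ := fun θ => {y | c < θ * y - Γ θ} with hH
  have hHopen : ∀ θ, IsOpen (H θ) := fun θ => isOpen_lt continuous_const (by fun_prop)
  obtain ⟨θ₁, hθ₁, h1⟩ := hpos
  obtain ⟨θ₂, hθ₂, h2⟩ := hneg
  have hcomp : IsCompact (closure A ∩ Set.Icc ((c + Γ θ₂) / θ₂) ((c + Γ θ₁) / θ₁)) :=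
    isCompact_Icc.inter_left isClosed_closure
  obtain ⟨S, hSD, hSfin, hS⟩ := hcomp.elim_finite_subcover_image (b := D) (c := H)
    (fun θ _ => hHopen θ) (fun x hx => by
      obtain ⟨θ, hθ, hlt⟩ := hcov x hx.1
      exact Set.mem_biUnion hθ hlt)
  set S' : Finset ℝ := insert θ₁ (insert θ₂ hSfin.toFinset) with hS'
  have hS'D : ∀ θ ∈ S', θ ∈ D := by
    intro θ hθ
    simp only [hS', Finset.mem_insert, Set.Finite.mem_toFinset] at hθ
    rcases hθ with rfl | rfl | hθ
    · exact hθ₁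
    · exact hθ₂
    · exact hSD hθ
  have hAS : A ⊆ ⋃ θ ∈ S', H θ := by
    intro x hx
    by_cases hx1 : x ∈ H θ₁
    · exact Set.mem_biUnion (by simp [hS'] : θ₁ ∈ S') hx1
    by_cases hx2 : x ∈ H θ₂
    · exact Set.mem_biUnion (by simp [hS'] : θ₂ ∈ S') hx2
    have hx1 : θ₁ * x - Γ θ₁ ≤ c := not_lt.1 hx1
    have hx2 : θ₂ * x - Γ θ₂ ≤ c := not_lt.1 hx2
    have hxI : x ∈ Set.Icc ((c + Γ θ₂) / θ₂) ((c + Γ θ₁) / θ₁) := by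
      constructor
      · rw [div_le_iff_of_neg h2]; linarith
      · rw [le_div_iff₀ h1]; linarith
    obtain ⟨θ, hθ, hlt⟩ := Set.mem_iUnion₂.1 (hS ⟨subset_closure hx, hxI⟩)
    exact Set.mem_biUnion (by simp [hS', hθ] : θ ∈ S') hlt
  set ε := (b - b') / 2 with hε
  have hε0 : 0 < ε := by linarith
  have hHle : ∀ θ ∈ S', ∀ᶠ n : ℕ in atTop,
      μ n (H θ) ≤ ENNReal.ofReal (Real.exp (n * (b' + ε))) := by
    intro θ hθ
    obtain ⟨L, hL, hLe⟩ := h θ (hS'D θ hθ)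
    filter_upwards [hLe, hL.eventually_le_const (by linarith : Γ θ < Γ θ + ε)] with n hn hLn
    have h3 := setLIntegral_exp_le (μ := μ n) (hHopen θ).measurableSet (s := n) (θ := 0) (θ' := θ)
      (K := -(n * (Γ θ + c))) (fun y hy => by
        have hy : c < θ * y - Γ θ := hy
        have := mul_le_mul_of_nonneg_left hy.le (Nat.cast_nonneg (α := ℝ) n)
        nlinarith)
    simp only [zero_mul, mul_zero, Real.exp_zero, ENNReal.ofReal_one, lintegral_const, one_mul,
      Measure.restrict_apply MeasurableSet.univ, Set.univ_inter] at h3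
    refine h3.trans ?_
    rw [hn, ← ENNReal.ofReal_mul (Real.exp_pos _).le, ← Real.exp_add]
    refine ENNReal.ofReal_le_ofReal (Real.exp_le_exp.2 ?_)
    have := mul_le_mul_of_nonneg_left hLn (Nat.cast_nonneg (α := ℝ) n)
    rw [hc]
    nlinarith
  have hfinal : ∀ᶠ n : ℕ in atTop, μ n A ≤ ENNReal.ofReal (Real.exp (n * b)) := by
    filter_upwards [(Finset.eventually_all S').2 hHle, eventually_le_exp_mul (S'.card : ℝ) hε0]
      with n hn hcard
    calc μ n A ≤ μ n (⋃ θ ∈ S', H θ) := measure_mono hAS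
      _ ≤ ∑ θ ∈ S', μ n (H θ) := measure_biUnion_finset_le _ _
      _ ≤ ∑ θ ∈ S', ENNReal.ofReal (Real.exp (n * (b' + ε))) := Finset.sum_le_sum hn
      _ = ENNReal.ofReal (S'.card * Real.exp (n * (b' + ε))) := by
          rw [Finset.sum_const, nsmul_eq_mul, ENNReal.ofReal_mul (by positivity),
            ENNReal.ofReal_natCast]
      _ ≤ ENNReal.ofReal (Real.exp (n * ε) * Real.exp (n * (b' + ε))) :=
          ENNReal.ofReal_le_ofReal (mul_le_mul_of_nonneg_right hcard (Real.exp_pos _).le)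
      _ = ENNReal.ofReal (Real.exp (n * b)) := by
          rw [← Real.exp_add]; congr 2; rw [hε]; ring
  exact absurd (limsup_inv_mul_log_le hfinal) (not_le.2 hb2)

/-- The lower bound at an exposed point `y`, with exposing slope `θ`: under the tilted laws, with
density proportional to `e^{nθz}`, the mass concentrates near `y` by two Chernoff bounds. -/
lemma neg_le_liminf_of_exposed {μ : ℕ → Measure ℝ} [∀ n, IsProbabilityMeasure (μ n)] {θ y γ : ℝ}
    (h : HasScaledLogMGF μ θ γ)
    (hup : ∀ δ > 0, ∃ η > 0, ∃ γ', HasScaledLogMGF μ (θ + η) γ' ∧ γ' - γ < η * (y + δ))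
    (hdown : ∀ δ > 0, ∃ η > 0, ∃ γ', HasScaledLogMGF μ (θ - η) γ' ∧ γ' - γ < -(η * (y - δ)))
    {U : Set ℝ} (hU : IsOpen U) (hy : y ∈ U) :
    ((-(θ * y - γ) : ℝ) : EReal) ≤
      liminf (fun n : ℕ => (((n : ℝ)⁻¹ : ℝ) : EReal) * ENNReal.log (μ n U)) atTop := by
  by_contra hcon
  obtain ⟨r, hr1, hr2⟩ := EReal.lt_iff_exists_real_btwn.1 (not_le.1 hcon)
  rw [EReal.coe_lt_coe_iff] at hr2
  refine absurd (le_liminf_inv_mul_log ?_) (not_le.2 hr1)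
  set g := γ - θ * y - r with hg
  have hg0 : 0 < g := by linarith
  obtain ⟨δ₀, hδ₀, hball⟩ := Metric.isOpen_iff.1 hU y hy
  set δ := min δ₀ (g / (4 * (|θ| + 1))) with hδ
  have hθ1 : 0 < |θ| + 1 := by positivity
  have hδ0 : 0 < δ := lt_min hδ₀ (by positivity)
  have hθδ : |θ| * δ ≤ g / 4 := by
    have h1 : δ * (4 * (|θ| + 1)) ≤ g := by
      rw [← le_div_iff₀ (by positivity)]; exact min_le_right _ _
    nlinarith
  obtain ⟨η₁, hη₁, γ₁, ⟨L₁, hL₁, hL₁e⟩, h1⟩ := hup δ hδ0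
  obtain ⟨η₂, hη₂, γ₂, ⟨L₂, hL₂, hL₂e⟩, h2⟩ := hdown δ hδ0
  obtain ⟨L, hL, hLe⟩ := h
  set κ := min (g / 4) (min (η₁ * (y + δ) - (γ₁ - γ)) (-(η₂ * (y - δ)) - (γ₂ - γ))) with hκ
  have hκ0 : 0 < κ := lt_min (by linarith) (lt_min (by linarith) (by linarith))
  have hκg : κ ≤ g / 4 := min_le_left _ _
  have hκ1 : κ ≤ η₁ * (y + δ) - (γ₁ - γ) := (min_le_right _ _).trans (min_le_left _ _)
  have hκ2 : κ ≤ -(η₂ * (y - δ)) - (γ₂ - γ) := (min_le_right _ _).trans (min_le_right _ _)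
  filter_upwards [hLe, hL₁e, hL₂e, hL.eventually_const_le (by linarith : γ - κ / 4 < γ),
    hL₁.eventually_le_const (by linarith : γ₁ < γ₁ + κ / 4),
    hL₂.eventually_le_const (by linarith : γ₂ < γ₂ + κ / 4),
    eventually_le_exp_mul 4 (by linarith : 0 < κ / 4)] with n hn hn1 hn2 hLn hLn1 hLn2 h4
  have hn0 : (0 : ℝ) ≤ n := Nat.cast_nonneg n
  set B := Set.Ioo (y - δ) (y + δ) with hB
  have hBU : B ⊆ U := by
    intro z hz
    refine hball ?_
    rw [Metric.mem_ball, Real.dist_eq, abs_lt]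
    have := min_le_left δ₀ (g / (4 * (|θ| + 1)))
    constructor <;> linarith [hz.1, hz.2]
  set p := (μ n B).toReal with hp
  have hpB : μ n B = ENNReal.ofReal p := (ENNReal.ofReal_toReal (measure_ne_top _ _)).symm
  have hp0 : 0 ≤ p := ENNReal.toReal_nonneg
  -- contribution of the ball
  have hIB : ∫⁻ z in B, ENNReal.ofReal (Real.exp (n * (θ * z))) ∂(μ n) ≤
      ENNReal.ofReal (Real.exp (n * (θ * y + |θ| * δ)) * p) := by
    rw [ENNReal.ofReal_mul (Real.exp_pos _).le, ← hpB, ← setLIntegral_const]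
    refine setLIntegral_mono' measurableSet_Ioo fun z hz => ?_
    refine ENNReal.ofReal_le_ofReal (Real.exp_le_exp.2 (mul_le_mul_of_nonneg_left ?_ hn0))
    have h5 : θ * (z - y) ≤ |θ| * δ := by
      refine (le_abs_self _).trans ?_
      rw [abs_mul]
      refine mul_le_mul_of_nonneg_left ?_ (abs_nonneg _)
      rw [abs_le]
      constructor <;> linarith [hz.1, hz.2]
    linarith
  -- contributions of the two tails
  have hI1 : ∫⁻ z in Set.Ici (y + δ), ENNReal.ofReal (Real.exp (n * (θ * z))) ∂(μ n) ≤
      ENNReal.ofReal (Real.exp (n * (γ - 3 * κ / 4))) := by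
    refine (setLIntegral_exp_le measurableSet_Ici (θ' := θ + η₁) (K := -(n * (η₁ * (y + δ))))
      fun z hz => ?_).trans ?_
    · have : y + δ ≤ z := hz
      have := mul_le_mul_of_nonneg_left (mul_le_mul_of_nonneg_left this hη₁.le) hn0
      nlinarith
    · rw [hn1, ← ENNReal.ofReal_mul (Real.exp_pos _).le, ← Real.exp_add]
      refine ENNReal.ofReal_le_ofReal (Real.exp_le_exp.2 ?_)
      have : L₁ n - η₁ * (y + δ) ≤ γ - 3 * κ / 4 := by linarith
      have := mul_le_mul_of_nonneg_left this hn0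
      linarith
  have hI2 : ∫⁻ z in Set.Iic (y - δ), ENNReal.ofReal (Real.exp (n * (θ * z))) ∂(μ n) ≤
      ENNReal.ofReal (Real.exp (n * (γ - 3 * κ / 4))) := by
    refine (setLIntegral_exp_le measurableSet_Iic (θ' := θ - η₂) (K := n * (η₂ * (y - δ)))
      fun z hz => ?_).trans ?_
    · have : z ≤ y - δ := hz
      have := mul_le_mul_of_nonneg_left (mul_le_mul_of_nonneg_left this hη₂.le) hn0
      nlinarith
    · rw [hn2, ← ENNReal.ofReal_mul (Real.exp_pos _).le, ← Real.exp_add]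
      refine ENNReal.ofReal_le_ofReal (Real.exp_le_exp.2 ?_)
      have : L₂ n + η₂ * (y - δ) ≤ γ - 3 * κ / 4 := by linarith
      have := mul_le_mul_of_nonneg_left this hn0
      linarith
  have hcover : (Set.univ : Set ℝ) ⊆ B ∪ (Set.Ici (y + δ) ∪ Set.Iic (y - δ)) := by
    intro z _
    by_cases hz1 : y + δ ≤ z
    · exact Or.inr (Or.inl hz1)
    by_cases hz2 : z ≤ y - δ
    · exact Or.inr (Or.inr hz2)
    exact Or.inl ⟨not_le.1 hz2, not_le.1 hz1⟩
  have htot : Real.exp (n * (γ - κ / 4)) ≤ Real.exp (n * (θ * y + |θ| * δ)) * p +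
      (Real.exp (n * (γ - 3 * κ / 4)) + Real.exp (n * (γ - 3 * κ / 4))) := by
    have h6 : ENNReal.ofReal (Real.exp (n * (γ - κ / 4))) ≤
        ENNReal.ofReal (Real.exp (n * (θ * y + |θ| * δ)) * p +
        (Real.exp (n * (γ - 3 * κ / 4)) + Real.exp (n * (γ - 3 * κ / 4)))) := by
      calc ENNReal.ofReal (Real.exp (n * (γ - κ / 4)))
          ≤ ENNReal.ofReal (Real.exp (n * L n)) :=
            ENNReal.ofReal_le_ofReal (Real.exp_le_exp.2 (mul_le_mul_of_nonneg_left hLn hn0))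
        _ = ∫⁻ z in Set.univ, ENNReal.ofReal (Real.exp (n * (θ * z))) ∂(μ n) := by
            rw [setLIntegral_univ, hn]
        _ ≤ ∫⁻ z in B ∪ (Set.Ici (y + δ) ∪ Set.Iic (y - δ)),
              ENNReal.ofReal (Real.exp (n * (θ * z))) ∂(μ n) := lintegral_mono_set hcover
        _ ≤ _ := (lintegral_union_le _ _ _).trans
              (add_le_add hIB ((lintegral_union_le _ _ _).trans (add_le_add hI1 hI2)))
        _ = _ := by
            rw [ENNReal.ofReal_add (by positivity) (by positivity),
              ENNReal.ofReal_add (by positivity) (by positivity)]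
    rwa [ENNReal.ofReal_le_ofReal_iff (by positivity)] at h6
  refine le_trans ?_ (measure_mono hBU)
  rw [hpB]
  refine ENNReal.ofReal_le_ofReal ?_
  -- divide by the exponential factors
  have e1 : Real.exp (n * (γ - κ / 4)) =
      Real.exp (n * (κ / 4)) * Real.exp (n * (κ / 4)) * Real.exp (n * (γ - 3 * κ / 4)) := by
    rw [← Real.exp_add, ← Real.exp_add]; ring_nf
  have e2 : Real.exp (n * (θ * y + |θ| * δ)) * Real.exp (n * r) ≤
      Real.exp (n * (γ - 3 * κ / 4)) := by
    rw [← Real.exp_add]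
    refine Real.exp_le_exp.2 ?_
    rw [← mul_add]
    refine mul_le_mul_of_nonneg_left ?_ hn0
    linarith
  have hE := Real.exp_pos (n * (γ - 3 * κ / 4))
  rw [e1] at htot
  have h7 : (3 : ℝ) * Real.exp (n * (γ - 3 * κ / 4)) ≤
      Real.exp (n * (κ / 4)) * Real.exp (n * (κ / 4)) * Real.exp (n * (γ - 3 * κ / 4)) := by
    refine mul_le_mul_of_nonneg_right ?_ hE.le
    nlinarith
  have h8 : Real.exp (n * (θ * y + |θ| * δ)) * Real.exp (n * r) ≤
      Real.exp (n * (θ * y + |θ| * δ)) * p := by linarith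
  exact le_of_mul_le_mul_left h8 (Real.exp_pos _)

end GartnerEllis

/-! ### Minimal solutions of the fixed-point equation -/

section FixedPoints

variable {Ω : Type*} [MeasurableSpace Ω] {P : Measure Ω} {a : ℝ} {Y : Ω → ℝ}

lemma isCriticalPoint_iff {x : ℝ} :
    IsCriticalPoint P a Y x ↔ IsCritical P (fun ω => a * Y ω) x :=
  ⟨fun h => ⟨h.1, h.2.1, h.2.2.1, h.2.2.2⟩, fun h => ⟨h.1, h.2, h.3, h.4⟩⟩

variable [IsProbabilityMeasure P]

lemma mem_fixedPoints_iff {x θ : ℝ} : x ∈ fixedPoints P a Y θ ↔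
    0 < x ∧ Integrable (fun ω => Real.exp (a * Y ω * (x - 1))) P ∧
      rootParam P (fun ω => a * Y ω) x = θ := by
  have hfun : (fun ω => Real.exp (θ + a * Y ω * (x - 1))) =
      fun ω => Real.exp θ * Real.exp (a * Y ω * (x - 1)) := by
    funext ω; rw [Real.exp_add]
  have hint : Integrable (fun ω => Real.exp (θ + a * Y ω * (x - 1))) P ↔
      Integrable (fun ω => Real.exp (a * Y ω * (x - 1))) P := by
    rw [hfun]; exact integrable_const_mul_iff (Real.exp_pos θ).ne'.isUnit _
  have hval : ∫ ω, Real.exp (θ + a * Y ω * (x - 1)) ∂P =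
      Real.exp θ * offspringGF P (fun ω => a * Y ω) x := by
    rw [hfun, integral_const_mul]; rfl
  rw [fixedPoints, Set.mem_ofPred_eq, hint, hval]
  constructor
  · rintro ⟨hi, he⟩
    have hf : 0 < offspringGF P (fun ω => a * Y ω) x := offspringGF_pos hi
    have hx : 0 < x := by rw [he]; exact mul_pos (Real.exp_pos _) hf
    exact ⟨hx, hi, (eq_exp_mul_offspringGF_iff hx hf).1 he⟩
  · rintro ⟨hx, hi, he⟩
    exact ⟨hi, (eq_exp_mul_offspringGF_iff hx (offspringGF_pos hi)).2 he⟩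

lemma IsCritical.isLeast_fixedPoints {xc : ℝ} (hc : IsCritical P (fun ω => a * Y ω) xc)
    (hm : AEMeasurable (fun ω => a * Y ω) P) (hV : ∀ᵐ ω ∂P, 0 < a * Y ω) {x : ℝ}
    (hx : x ∈ Set.Ioc 0 xc) :
    IsLeast (fixedPoints P a Y (rootParam P (fun ω => a * Y ω) x)) x := by
  refine ⟨mem_fixedPoints_iff.2 ⟨hx.1, integrable_exp_of_le hm hV hx.2 hc.integrable_exp, rfl⟩,
    fun z hz => ?_⟩
  obtain ⟨hz0, -, hzT⟩ := mem_fixedPoints_iff.1 hz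
  by_contra h
  have h := not_le.1 h
  exact (hc.strictMonoOn_rootParam hm hV ⟨hz0, (h.trans_le hx.2).le⟩ hx h).ne hzT

lemma IsCritical.limitLogMGF_rootParam {xc : ℝ} (hc : IsCritical P (fun ω => a * Y ω) xc)
    (hm : AEMeasurable (fun ω => a * Y ω) P) (hV : ∀ᵐ ω ∂P, 0 < a * Y ω) (ν : ℝ) {x : ℝ}
    (hx : x ∈ Set.Ioc 0 xc) :
    limitLogMGF P ν a Y (rootParam P (fun ω => a * Y ω) x) = ν * (x - 1) := by
  rw [limitLogMGF, minFixedPoint, (hc.isLeast_fixedPoints hm hV hx).csInf_eq]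

end FixedPoints

section Limit

variable {Ω : Type*} [MeasurableSpace Ω] {P : Measure Ω} [IsProbabilityMeasure P] {ν : ℝ}
  {α : ℕ → ℝ} {ℓ : ℕ → ℕ → Ω → ℝ} {Z : ℕ → Ω → ℕ}

lemma l1Norm_pos (hα : ∀ t, 1 ≤ t → 0 ≤ α t) (hα_ne : ∃ t, 1 ≤ t ∧ 0 < α t)
    (hα_sum : Summable (fun t : ℕ => α (t + 1))) : 0 < l1Norm α := by
  obtain ⟨t, ht, hpos⟩ := hα_ne
  refine hα_sum.tsum_pos (fun s => hα _ (by omega)) (t - 1) ?_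
  rwa [Nat.sub_add_cancel ht]

/-- The scaled logarithmic moment generating function of `N_t / t` at `θ = T(x)` converges to
`ν (x - 1)`, as a Cesàro limit of the cluster generating functions. -/
lemma IsMarkedHawkes.hasScaledLogMGF (hZ : IsMarkedHawkes P ν α ℓ Z) (hν : 0 < ν)
    (hα : ∀ t, 1 ≤ t → 0 ≤ α t) (ha : 0 < l1Norm α)
    (hα_sum : Summable (fun t : ℕ => α (t + 1)))
    (hm : AEMeasurable (meanOffspring α ℓ) P) (hV : ∀ᵐ ω ∂P, 0 < meanOffspring α ℓ ω)
    {xc : ℝ} (hc : IsCritical P (meanOffspring α ℓ) xc) {x : ℝ} (hx : x ∈ Set.Ioc 0 xc) :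
    HasScaledLogMGF (fun t : ℕ => P.map (fun ω => (count Z t ω : ℝ) / (t : ℝ)))
      (rootParam P (meanOffspring α ℓ) x) (ν * (x - 1)) := by
  set V := meanOffspring α ℓ with hVdef
  set θ := rootParam P V x with hθ
  have hie : ∀ y ≤ xc, Integrable (fun ω => Real.exp (V ω * (y - 1))) P :=
    fun y hy => integrable_exp_of_le hm hV hy hc.integrable_exp
  have hroot : ∀ y ∈ Set.Ioc 0 xc, (y = Real.exp θ * offspringGF P V y ↔ rootParam P V y = θ) :=
    fun y hy => eq_exp_mul_offspringGF_iff hy.1 (offspringGF_pos (hie y hy.2))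
  have hmonoT := hc.strictMonoOn_rootParam hm hV
  have hw : ∀ s, 0 ≤ lagWeight α s := fun s => div_nonneg (hα _ (by omega)) ha.le
  have hw1 : HasSum (lagWeight α) 1 := by
    have := hα_sum.hasSum.div_const (l1Norm α)
    rwa [show ∑' t : ℕ, α (t + 1) = l1Norm α from rfl, div_self ha.ne'] at this
  obtain ⟨harg, hlim⟩ := tendsto_clusterGF (f := offspringGF P V) (θ := θ) hw hw1 hc.one_lt
    (fun y _ z hz hyz => offspringGF_mono hm hV hyz (hie z hz))
    (continuousOn_offspringGF hm hV hc.integrable_exp) offspringGF_one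
    (fun y hy => offspringGF_pos (hie y hy)) hx ((hroot x hx).2 rfl)
    (fun y hy h => hmonoT.injOn hy hx ((hroot y hy).1 h))
    (fun h0 => by
      rw [hθ, ← rootParam_one (P := P) (V := V),
        hmonoT.le_iff_le ⟨one_pos, hc.one_lt.le⟩ hx] at h0
      exact h0)
  refine ⟨fun t => ν * ((t : ℝ)⁻¹ *
    ∑ k ∈ Finset.range t, (hawkesClusterGF P α ℓ θ (k + 1) - 1)), ?_, ?_⟩
  · exact (((tendsto_add_atTop_iff_nat 1).2 hlim).sub_const 1).cesaro.const_mul ν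
  · filter_upwards [eventually_gt_atTop 0] with t ht
    have ht' : (t : ℝ) ≠ 0 := by positivity
    have hcm : Measurable (fun ω => (count Z t ω : ℝ) / (t : ℝ)) :=
      (measurable_from_top.comp (hZ.measurable_totalCount t)).div_const _
    rw [lintegral_map (by fun_prop) hcm]
    have h1 : ∀ ω, (t : ℝ) * (θ * ((count Z t ω : ℝ) / (t : ℝ))) = θ * count Z t ω := by
      intro ω; field_simp
    simp only [h1]
    rw [hZ.lintegral_exp_count hν hα ha.ne' (fun n => hie _ (harg n)) t]
    congr 2
    field_simp

end Limit

/-! ### The rate function and the lower bound -/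

section LowerBound

variable {Ω : Type*} [MeasurableSpace Ω] {P : Measure Ω}

lemma lowerSemicontinuous_rateFunction (ν a : ℝ) (Y : Ω → ℝ) (θc : ℝ) :
    LowerSemicontinuous (rateFunction P ν a Y θc) :=
  lowerSemicontinuous_biSup fun θ _ =>
    (continuous_coe_real_ereal.comp (by fun_prop)).lowerSemicontinuous

lemma le_rateFunction {ν a : ℝ} {Y : Ω → ℝ} {θ θc : ℝ} (hθ : θ ≤ θc) (x : ℝ) :
    ((θ * x - limitLogMGF P ν a Y θ : ℝ) : EReal) ≤ rateFunction P ν a Y θc x :=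
  le_iSup₂ (f := fun θ (_ : θ ∈ Set.Iic θc) => ((θ * x - limitLogMGF P ν a Y θ : ℝ) : EReal)) θ hθ

variable [IsProbabilityMeasure P] {μ : ℕ → Measure ℝ} [∀ n, IsProbabilityMeasure (μ n)]
  {V : Ω → ℝ} {ν xc : ℝ}

/-- Every `y > 0` is exposed, by the slope `T(x)` with `T'(x) = ν / y`. -/
lemma IsCritical.exists_le_liminf (hc : IsCritical P V xc) (hm : AEMeasurable V P)
    (hV : ∀ᵐ ω ∂P, 0 < V ω) (hν : 0 < ν)
    (hμ : ∀ x ∈ Set.Ioc 0 xc, HasScaledLogMGF μ (rootParam P V x) (ν * (x - 1)))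
    {U : Set ℝ} (hU : IsOpen U) {y : ℝ} (hy : y ∈ U) (hy0 : 0 < y) :
    ∃ x ∈ Set.Ioc 0 xc, ((-(rootParam P V x * y - ν * (x - 1)) : ℝ) : EReal) ≤
      liminf (fun n : ℕ => (((n : ℝ)⁻¹ : ℝ) : EReal) * ENNReal.log (μ n U)) atTop := by
  obtain ⟨x, hx, hd⟩ := hc.exists_hasDerivAt_rootParam hm hV (div_pos hν hy0)
  have hxm : x ∈ Set.Ioc 0 xc := ⟨hx.1, hx.2.le⟩
  have hmonoT := hc.strictMonoOn_rootParam hm hV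
  have hslope := hasDerivAt_iff_tendsto_slope.1 hd
  refine ⟨x, hxm, neg_le_liminf_of_exposed (hμ x hxm) (fun δ hδ => ?_) (fun δ hδ => ?_) hU hy⟩
  · have hlt : ν < ν / y * (y + δ) := by
      rw [div_mul_eq_mul_div, lt_div_iff₀ hy0]; nlinarith
    have hev := ((hslope.mono_left (nhdsGT_le_nhdsNE x)).mul_const (y + δ)).eventually_const_lt hlt
    obtain ⟨x', hx'1, hx'⟩ := (hev.and (Ioo_mem_nhdsGT hx.2)).exists
    have hx'm : x' ∈ Set.Ioc 0 xc := ⟨hx.1.trans hx'.1, hx'.2.le⟩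
    refine ⟨rootParam P V x' - rootParam P V x, sub_pos.2 (hmonoT hxm hx'm hx'.1),
      ν * (x' - 1), by rw [add_sub_cancel]; exact hμ x' hx'm, ?_⟩
    have hpos : 0 < x' - x := sub_pos.2 hx'.1
    rw [slope_def_field, div_mul_eq_mul_div, lt_div_iff₀ hpos] at hx'1
    linarith
  · have hlt : ν / y * (y - δ) < ν := by
      rw [div_mul_eq_mul_div, div_lt_iff₀ hy0]; nlinarith
    have hev := ((hslope.mono_left (nhdsLT_le_nhdsNE x)).mul_const (y - δ)).eventually_lt_const hlt
    obtain ⟨x', hx'1, hx'⟩ := (hev.and (Ioo_mem_nhdsLT hx.1)).exists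
    have hx'm : x' ∈ Set.Ioc 0 xc := ⟨hx'.1, (hx'.2.trans hx.2).le⟩
    refine ⟨rootParam P V x - rootParam P V x', sub_pos.2 (hmonoT hx'm hxm hx'.2),
      ν * (x' - 1), by rw [sub_sub_cancel]; exact hμ x' hx'm, ?_⟩
    have hneg : x' - x < 0 := sub_neg.2 hx'.2
    rw [slope_def_field, div_mul_eq_mul_div, div_lt_iff_of_neg hneg] at hx'1
    linarith

/-- The lower bound at every point of an open set: `I = ∞` on `(-∞, 0)`, positive points are
exposed, and `0` is approached by positive points, since `I(0) = ν`. -/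
lemma IsCritical.neg_rateFunction_le_liminf {a : ℝ} {Y : Ω → ℝ}
    (hc : IsCritical P (fun ω => a * Y ω) xc) (hm : AEMeasurable (fun ω => a * Y ω) P)
    (hV : ∀ᵐ ω ∂P, 0 < a * Y ω) (hν : 0 < ν)
    (hμ : ∀ x ∈ Set.Ioc 0 xc,
      HasScaledLogMGF μ (rootParam P (fun ω => a * Y ω) x) (ν * (x - 1)))
    {U : Set ℝ} (hU : IsOpen U) {y : ℝ} (hy : y ∈ U) :
    -rateFunction P ν a Y (rootParam P (fun ω => a * Y ω) xc) y ≤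
      liminf (fun n : ℕ => (((n : ℝ)⁻¹ : ℝ) : EReal) * ENNReal.log (μ n U)) atTop := by
  set V : Ω → ℝ := fun ω => a * Y ω with hVdef
  set θc := rootParam P V xc with hθc
  have hmonoT := hc.strictMonoOn_rootParam hm hV
  have hxc : 0 < xc := by linarith [hc.one_lt]
  have hTle : ∀ x ∈ Set.Ioc 0 xc, rootParam P V x ≤ θc := fun x hx =>
    hmonoT.monotoneOn hx ⟨hxc, le_rfl⟩ hx.2
  have hIle : ∀ x ∈ Set.Ioc 0 xc, ∀ z,
      ((rootParam P V x * z - ν * (x - 1) : ℝ) : EReal) ≤ rateFunction P ν a Y θc z := by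
    intro x hx z
    rw [← hc.limitLogMGF_rootParam hm hV ν hx]
    exact le_rateFunction (hTle x hx) z
  have hθc0 : 0 < θc := hc.rootParam_pos hV
  rcases lt_trichotomy y 0 with hy0 | rfl | hy0
  · have htop : rateFunction P ν a Y θc y = ⊤ := by
      rw [EReal.eq_top_iff_forall_lt]
      intro M
      have hθ : (|M| + 1) / y ≤ 0 := div_nonpos_of_nonneg_of_nonpos (by positivity) hy0.le
      obtain ⟨x, hx, hxT⟩ := hc.exists_rootParam_eq hm hV (hθ.trans hθc0.le)
      have hx1 : x ≤ 1 := by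
        rw [← hmonoT.le_iff_le hx ⟨one_pos, hc.one_lt.le⟩, hxT, rootParam_one]; exact hθ
      refine lt_of_lt_of_le (EReal.coe_lt_coe_iff.2 ?_) (hIle x hx y)
      rw [hxT, div_mul_cancel₀ _ hy0.ne]
      have := le_abs_self M
      have : ν * (x - 1) ≤ 0 := mul_nonpos_of_nonneg_of_nonpos hν.le (by linarith)
      linarith
    rw [htop, EReal.neg_top]
    exact bot_le
  · by_contra hcon
    obtain ⟨r, hr1, hr2⟩ := EReal.lt_iff_exists_real_btwn.1 (not_le.1 hcon)
    obtain ⟨r', hr'1, hr'2⟩ := EReal.lt_iff_exists_real_btwn.1 hr1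
    rw [EReal.coe_lt_coe_iff] at hr'2
    -- `I(0) ≥ ν (1 - x)` for small `x > 0`
    set x := min xc ((r - r') / (4 * ν)) with hxdef
    have hx : x ∈ Set.Ioc 0 xc :=
      ⟨lt_min hxc (div_pos (by linarith) (by positivity)), min_le_left _ _⟩
    have hxν : ν * x ≤ (r - r') / 4 := by
      have : x ≤ (r - r') / (4 * ν) := min_le_right _ _
      rw [le_div_iff₀ (by positivity)] at this
      linarith
    have h1 : r < -(rootParam P V x * 0 - ν * (x - 1)) := by
      rw [← EReal.coe_lt_coe_iff, EReal.coe_neg]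
      exact hr2.trans_le (EReal.neg_le_neg_iff.2 (hIle x hx 0))
    -- a positive point of `U` close to `0`
    obtain ⟨ε, hε, hball⟩ := Metric.isOpen_iff.1 hU 0 hy
    set z := min (ε / 2) ((r - r') / (4 * θc)) with hzdef
    have hz0 : 0 < z := lt_min (by positivity) (div_pos (by linarith) (by positivity))
    have hzU : z ∈ U := by
      refine hball ?_
      rw [Metric.mem_ball, Real.dist_eq, sub_zero, abs_of_pos hz0]
      have : z ≤ ε / 2 := min_le_left _ _
      linarith
    have hzθ : θc * z ≤ (r - r') / 4 := by
      have : z ≤ (r - r') / (4 * θc) := min_le_right _ _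
      rw [le_div_iff₀ (by positivity)] at this
      linarith
    obtain ⟨w, hw, hwle⟩ := hc.exists_le_liminf hm hV hν hμ hU hzU hz0
    have h2 : -(rootParam P V w * z - ν * (w - 1)) < r' := by
      rw [← EReal.coe_lt_coe_iff]
      exact hwle.trans_lt hr'1
    have h3 := mul_le_mul_of_nonneg_right (hTle w hw) hz0.le
    have h4 : 0 < ν * w := mul_pos hν hw.1
    linarith
  · obtain ⟨x, hx, hle⟩ := hc.exists_le_liminf hm hV hν hμ hU hy hy0
    refine le_trans ?_ hle
    rw [EReal.coe_neg, EReal.neg_le_neg_iff]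
    exact hIle x hx y

end LowerBound

end HawkesLDP

end

theorem theorem1 {Ω : Type*} [MeasurableSpace Ω] (P : Measure Ω) [IsProbabilityMeasure P]
    (ν : ℝ) (hν : 0 < ν)
    (α : ℕ → ℝ) (hα : ∀ t, 1 ≤ t → 0 ≤ α t) (hα_ne : ∃ t, 1 ≤ t ∧ 0 < α t)
    (hα_sum : Summable (fun t : ℕ => α (t + 1)))
    (ℓ : ℕ → ℕ → Ω → ℝ) (Z : ℕ → Ω → ℕ)
    (hZ : HawkesLDP.IsMarkedHawkes P ν α ℓ Z)
    (hℓ : Integrable (ℓ 1 1) P)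
    (hsub : HawkesLDP.l1Norm α * ∫ ω, ℓ 1 1 ω ∂P < 1) :
    -- existence of the critical point
    (IsOpen {u : ℝ | Integrable (fun ω => Real.exp (u * ℓ 1 1 ω)) P} →
      ∃ xc : ℝ, HawkesLDP.IsCriticalPoint P (HawkesLDP.l1Norm α) (ℓ 1 1) xc) ∧
    ∀ xc : ℝ, HawkesLDP.IsCriticalPoint P (HawkesLDP.l1Norm α) (ℓ 1 1) xc →
      -- uniqueness of the critical point
      (∀ x : ℝ, HawkesLDP.IsCriticalPoint P (HawkesLDP.l1Norm α) (ℓ 1 1) x → x = xc) ∧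
      ∀ θc : ℝ, θc = HawkesLDP.criticalTheta P (HawkesLDP.l1Norm α) (ℓ 1 1) xc →
        0 < θc ∧
        -- at `θc` the point `xc` is a double root of the fixed-point equation
        xc ∈ HawkesLDP.fixedPoints P (HawkesLDP.l1Norm α) (ℓ 1 1) θc ∧
        ∫ ω, HawkesLDP.l1Norm α * ℓ 1 1 ω *
          Real.exp (θc + HawkesLDP.l1Norm α * ℓ 1 1 ω * (xc - 1)) ∂P = 1 ∧
        -- `θc` is critical: there is a minimal solution up to `θc`, and no solution beyond
        (∀ θ : ℝ, θ ≤ θc →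
          IsLeast (HawkesLDP.fixedPoints P (HawkesLDP.l1Norm α) (ℓ 1 1) θ)
            (HawkesLDP.minFixedPoint P (HawkesLDP.l1Norm α) (ℓ 1 1) θ)) ∧
        (∀ θ : ℝ, θc < θ → HawkesLDP.fixedPoints P (HawkesLDP.l1Norm α) (ℓ 1 1) θ = ∅) ∧
        -- the large deviation principle for the laws of `N_t / t`
        HawkesLDP.LargeDeviationPrinciple
          (fun t : ℕ => P.map (fun ω => (HawkesLDP.count Z t ω : ℝ) / (t : ℝ)))
          (fun t : ℕ => (t : ℝ))
          (HawkesLDP.rateFunction P ν (HawkesLDP.l1Norm α) (ℓ 1 1) θc) := by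
  open HawkesLDP in
  have ha : 0 < l1Norm α := l1Norm_pos hα hα_ne hα_sum
  set a := l1Norm α with hadef
  have hVi : Integrable (fun ω => a * ℓ 1 1 ω) P := hℓ.const_mul a
  have hm : AEMeasurable (fun ω => a * ℓ 1 1 ω) P := hVi.aemeasurable
  have hV : ∀ᵐ ω ∂P, 0 < a * ℓ 1 1 ω :=
    (hZ.mark_pos 1 1 le_rfl le_rfl).mono fun ω h => mul_pos ha h
  refine ⟨fun hopen => ?_, fun xc hxc => ?_⟩
  · obtain ⟨xc, hxc⟩ := exists_isCritical hV hVi (by rwa [integral_const_mul]) fun x hx => by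
      have hmem : a * (x - 1) ∈ {u : ℝ | Integrable (fun ω => Real.exp (u * ℓ 1 1 ω)) P} := by
        simpa [mul_right_comm] using hx
      have hcont : Tendsto (fun y : ℝ => a * (y - 1)) (𝓝[>] x) (𝓝 (a * (x - 1))) :=
        (Continuous.tendsto (by fun_prop) x).mono_left nhdsWithin_le_nhds
      obtain ⟨y, hy1, hy2⟩ :=
        ((hcont.eventually (hopen.mem_nhds hmem)).and self_mem_nhdsWithin).exists
      refine ⟨y, hy2, ?_⟩
      simpa [mul_right_comm] using hy1
    exact ⟨xc, isCriticalPoint_iff.2 hxc⟩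
  have hc := isCriticalPoint_iff.1 hxc
  refine ⟨fun x hx => (isCriticalPoint_iff.1 hx).unique hc hV, fun θc hθc => ?_⟩
  have hxc0 : 0 < xc := by linarith [hc.one_lt]
  have hθ : θc = rootParam P (fun ω => a * ℓ 1 1 ω) xc := by
    rw [hθc, hc.rootParam_eq]; rfl
  have hleast : ∀ θ ≤ θc, ∃ x ∈ Set.Ioc 0 xc, rootParam P (fun ω => a * ℓ 1 1 ω) x = θ :=
    fun θ h => hc.exists_rootParam_eq hm hV (hθ ▸ h)
  have hθ0 : 0 < θc := hθ ▸ hc.rootParam_pos hV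
  have hlog : ∀ x ∈ Set.Ioc 0 xc, HasScaledLogMGF
      (fun t : ℕ => P.map (fun ω => (count Z t ω : ℝ) / (t : ℝ)))
      (rootParam P (fun ω => a * ℓ 1 1 ω) x) (ν * (x - 1)) := fun x hx =>
    hZ.hasScaledLogMGF hν hα ha hα_sum hm hV hc hx
  have hprob : ∀ t : ℕ, IsProbabilityMeasure
      (P.map (fun ω => (count Z t ω : ℝ) / (t : ℝ))) := fun t =>
    Measure.isProbabilityMeasure_map
      ((measurable_from_top.comp (hZ.measurable_totalCount t)).div_const _).aemeasurable
  refine ⟨hθ0, mem_fixedPoints_iff.2 ⟨hxc0, hc.integrable_exp, hθ.symm⟩, ?_, ?_, ?_, ?_⟩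
  · have h1 : ∀ ω, a * ℓ 1 1 ω * Real.exp (θc + a * ℓ 1 1 ω * (xc - 1)) =
        Real.exp θc * (a * ℓ 1 1 ω * Real.exp (a * ℓ 1 1 ω * (xc - 1))) := by
      intro ω; rw [Real.exp_add]; ring
    have hd := hc.deriv_pos
    simp only [h1]
    rw [integral_const_mul, hθ, hc.rootParam_eq, Real.exp_neg, Real.exp_log hd]
    exact inv_mul_cancel₀ hd.ne'
  · intro θ h
    obtain ⟨x, hx, rfl⟩ := hleast θ h
    have hl := hc.isLeast_fixedPoints hm hV hx
    rw [minFixedPoint, hl.csInf_eq]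
    exact hl
  · intro θ h
    refine Set.eq_empty_of_forall_notMem fun x hx => ?_
    obtain ⟨hx0, hxi, hxT⟩ := mem_fixedPoints_iff.1 hx
    rcases eq_or_ne x xc with rfl | hne
    · linarith
    · have := hc.rootParam_lt hV hx0 hxi hne
      linarith
  · have hΓ0 : limitLogMGF P ν a (ℓ 1 1) 0 = 0 := by
      have := hc.limitLogMGF_rootParam hm hV ν (x := 1) ⟨one_pos, hc.one_lt.le⟩
      rwa [rootParam_one, sub_self, mul_zero] at this
    refine ⟨lowerSemicontinuous_rateFunction _ _ _ _, fun x => ?_, Nat.mono_cast,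
      tendsto_natCast_atTop_atTop, fun A _ => ?_, fun A _ => ?_⟩
    · have := le_rateFunction (P := P) (ν := ν) (a := a) (Y := ℓ 1 1) hθ0.le x
      rwa [hΓ0, zero_mul, sub_zero, EReal.coe_zero] at this
    · rw [EReal.neg_le]
      refine le_iInf₂ fun x hx => ?_
      rw [EReal.neg_le, hθ]
      refine (hc.neg_rateFunction_le_liminf hm hV hν hlog isOpen_interior hx).trans ?_
      refine liminf_le_liminf (Eventually.of_forall fun n => ?_)
      exact mul_le_mul_of_nonneg_left
        (ENNReal.log_monotone (measure_mono interior_subset)) (by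
          rw [← EReal.coe_zero, EReal.coe_le_coe_iff]; positivity)
    · refine limsup_le_neg_iInf_closure (D := Set.Iic θc) (Γ := limitLogMGF P ν a (ℓ 1 1))
        (fun θ h => ?_) ⟨θc, Set.self_mem_Iic, hθ0⟩ ⟨-1, ?_, by norm_num⟩ A
      · obtain ⟨x, hx, rfl⟩ := hleast θ h
        rw [hc.limitLogMGF_rootParam hm hV ν hx]
        exact hlog x hx
      · show (-1 : ℝ) ≤ θc
        linarith
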